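/- Let $n\ge 2$, $p,q\in[1,\infty]$, $s\in(0,1)$, and let $\Omega\subset\mathbb R^n$ be a bounded domain (nonempty, open, connected) with Lipschitz boundary. For $u:\Omega\to\mathbb R$ put $$[u]_{s,p,\Omega}^p=\int_\Omega\int_\Omega\frac{|u(x)-u(y)|^p}{|x-y|^{n+sp}}\,dx\,dy\quad(p<\infty),\qquad [u]_{s,\infty,\Omega}=\operatorname*{ess\,sup}_{x,y\in\Omega}\frac{|u(x)-u(y)|}{|x-y|^s},$$ and let the Banach space $M^{s;q,p}(\Omega)$ be the completion of the set of all functions in $C^1(\Omega)$ with finite norm $\|u\|_{M^{s;q,p}(\Omega)}:=\|u\|_{L^q(\Omega)}+[u]_{s,p,\Omega}$ with respect to this norm. For $1\le r\le\infty$, an embedding $\iota:M^{s;q,p}(\Omega)\to L^r(\Omega)$ means an injective linear map that extends the identity $u\mapsto u$ on these $C^1$ functions. (1) If $sp<n$, put $p^*_s:=\frac{np}{n-sp}$. Then there is a continuous embedding $\iota:M^{s;q,p}(\Omega)\to L^r(\Omega)$ for every $r$ with $1\le r\le\max\{p^*_s,q\}$ (including $r=\infty$ when $q=\infty$), and it is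 compact for every $r$ with $1\le r<\max\{p^*_s,q\}$. (2) If $sp\ge n$ (in particular if $p=\infty$), then there is a continuous and compact embedding $\iota:M^{s;q,p}(\Omega)\to L^r(\Omega)$ for every $r$ with $1\le r<\infty$. -/

import Mathlib

open MeasureTheory
open scoped ENNReal NNReal RealInnerProductSpace

/-- A bounded Lipschitz domain in `ℝⁿ`: a nonempty, connected, open, bounded set whose boundary is
locally the graph of a Lipschitz function.  That is, near each boundary point there are a unit
vector `e` and a Lipschitz function `φ` on the hyperplane orthogonal to `e` such that `Ω` is
the region lying strictly above the graph of `φ` in direction `e`. -/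
structure IsBoundedLipschitzDomain {n : ℕ} (Ω : Set (EuclideanSpace ℝ (Fin n))) : Prop where
  isOpen : IsOpen Ω
  isConnected : IsConnected Ω
  isBounded : Bornology.IsBounded Ω
  lipschitz_boundary : ∀ x ∈ frontier Ω, ∃ e : EuclideanSpace ℝ (Fin n), ‖e‖ = 1 ∧
    ∃ φ : (Submodule.span ℝ {e})ᗮ → ℝ, (∃ K : ℝ≥0, LipschitzWith K φ) ∧
      ∃ ρ : ℝ, 0 < ρ ∧ ∀ y ∈ Metric.ball x ρ,
        (y ∈ Ω ↔ φ ((Submodule.span ℝ {e})ᗮ.orthogonalProjectionOnto y) < ⟪e, y⟫)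

namespace FracSobolev

variable {n : ℕ}

/-- The difference quotient `(u x - u y) / |x - y| ^ (n / p + s)`.  For `p = ∞` the exponent is `s`
(here `p.toReal = 0`, so that `n / p.toReal = 0`). -/
noncomputable def quotient (s : ℝ) (p : ℝ≥0∞) (u : EuclideanSpace ℝ (Fin n) → ℝ) :
    EuclideanSpace ℝ (Fin n) × EuclideanSpace ℝ (Fin n) → ℝ :=
  fun z => (u z.1 - u z.2) / ‖z.1 - z.2‖ ^ ((n : ℝ) / p.toReal + s)

/-- The Gagliardo seminorm `[u]_{s,p,Ω}` with values in `[0, ∞]`.  For `p < ∞` its `p`-th power is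
`∫_Ω ∫_Ω |u x - u y| ^ p / |x - y| ^ (n + s p) dx dy`, and for `p = ∞` it is the essential
supremum of `|u x - u y| / |x - y| ^ s` over `Ω × Ω`. -/
noncomputable def gagliardo (Ω : Set (EuclideanSpace ℝ (Fin n))) (s : ℝ) (p : ℝ≥0∞)
    (u : EuclideanSpace ℝ (Fin n) → ℝ) : ℝ≥0∞ :=
  eLpNorm (quotient s p u) p ((volume.restrict Ω).prod (volume.restrict Ω))

theorem quotient_add (s : ℝ) (p : ℝ≥0∞) (u v : EuclideanSpace ℝ (Fin n) → ℝ) :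
    quotient s p (u + v) = quotient s p u + quotient s p v := by
  funext z
  simp only [quotient, Pi.add_apply]
  ring

theorem quotient_smul (s : ℝ) (p : ℝ≥0∞) (c : ℝ) (u : EuclideanSpace ℝ (Fin n) → ℝ) :
    quotient s p (c • u) = c • quotient s p u := by
  funext z
  simp only [quotient, Pi.smul_apply, smul_eq_mul]
  ring

/-- The functions in `C¹(Ω)` for which `‖u‖_{q,Ω} + [u]_{s,p,Ω}` is finite.  Functions are written
as functions on `ℝⁿ`; their values outside `Ω` play no role.  On a bounded Lipschitz domain this
space contains the restrictions of all functions in `C¹` of the closure of `Ω`. -/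
def c1Submodule (Ω : Set (EuclideanSpace ℝ (Fin n))) (s : ℝ) (q p : ℝ≥0∞) :
    Submodule ℝ (EuclideanSpace ℝ (Fin n) → ℝ) where
  carrier := {u | ContDiffOn ℝ 1 u Ω ∧ MemLp u q (volume.restrict Ω) ∧
    MemLp (quotient s p u) p ((volume.restrict Ω).prod (volume.restrict Ω))}
  zero_mem' := by
    have h : quotient s p (0 : EuclideanSpace ℝ (Fin n) → ℝ) = 0 := by
      funext z
      simp [quotient]
    refine ⟨contDiffOn_const, MemLp.zero, ?_⟩
    rw [h]
    exact MemLp.zero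
  add_mem' := by
    rintro u v ⟨hu, hu', hu''⟩ ⟨hv, hv', hv''⟩
    refine ⟨hu.add hv, hu'.add hv', ?_⟩
    rw [quotient_add]
    exact hu''.add hv''
  smul_mem' := by
    rintro c u ⟨hu, hu', hu''⟩
    refine ⟨hu.const_smul c, hu'.const_smul c, ?_⟩
    rw [quotient_smul]
    exact hu''.const_smul c

/-- The space `c1Submodule Ω s q p` as a type of its own, so that it carries only the topology of
the norm below. -/
def C1 (Ω : Set (EuclideanSpace ℝ (Fin n))) (s : ℝ) (q p : ℝ≥0∞) : Type :=
  c1Submodule Ω s q p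

section C1

variable {Ω : Set (EuclideanSpace ℝ (Fin n))} {s : ℝ} {q p : ℝ≥0∞}

noncomputable instance : AddCommGroup (C1 Ω s q p) :=
  inferInstanceAs (AddCommGroup (c1Submodule Ω s q p))

noncomputable instance : Module ℝ (C1 Ω s q p) :=
  inferInstanceAs (Module ℝ (c1Submodule Ω s q p))

/-- The underlying function. -/
def C1.fn (u : C1 Ω s q p) : EuclideanSpace ℝ (Fin n) → ℝ := Subtype.val u

theorem C1.memLp (u : C1 Ω s q p) : MemLp u.fn q (volume.restrict Ω) := u.2.2.1

theorem C1.memLp_quotient (u : C1 Ω s q p) :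
    MemLp (quotient s p u.fn) p ((volume.restrict Ω).prod (volume.restrict Ω)) := u.2.2.2

/-- The norm `‖u‖ = ‖u‖_{q,Ω} + [u]_{s,p,Ω}`. -/
noncomputable instance : Norm (C1 Ω s q p) where
  norm u := (eLpNorm u.fn q (volume.restrict Ω)).toReal + (gagliardo Ω s p u.fn).toReal

theorem C1.core [hq : Fact (1 ≤ q)] [hp : Fact (1 ≤ p)] :
    SeminormedSpace.Core ℝ (C1 Ω s q p) where
  norm_nonneg u := add_nonneg ENNReal.toReal_nonneg ENNReal.toReal_nonneg
  norm_smul c u := by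
    change (eLpNorm (c • u.fn) q _).toReal + (eLpNorm (quotient s p (c • u.fn)) p _).toReal =
      ‖c‖ * ((eLpNorm u.fn q _).toReal + (eLpNorm (quotient s p u.fn) p _).toReal)
    rw [quotient_smul, eLpNorm_const_smul, eLpNorm_const_smul, ENNReal.toReal_mul,
      ENNReal.toReal_mul, toReal_enorm]
    ring
  norm_triangle u v := by
    have h1 : (eLpNorm (u.fn + v.fn) q (volume.restrict Ω)).toReal ≤
        (eLpNorm u.fn q (volume.restrict Ω)).toReal +
          (eLpNorm v.fn q (volume.restrict Ω)).toReal := by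
      rw [← ENNReal.toReal_add u.memLp.2.ne v.memLp.2.ne]
      exact ENNReal.toReal_mono (ENNReal.add_ne_top.2 ⟨u.memLp.2.ne, v.memLp.2.ne⟩)
        (eLpNorm_add_le u.memLp.1 v.memLp.1 hq.out)
    have h2 : (gagliardo Ω s p (u.fn + v.fn)).toReal ≤
        (gagliardo Ω s p u.fn).toReal + (gagliardo Ω s p v.fn).toReal := by
      unfold gagliardo
      rw [quotient_add, ← ENNReal.toReal_add u.memLp_quotient.2.ne v.memLp_quotient.2.ne]
      exact ENNReal.toReal_mono (ENNReal.add_ne_top.2 ⟨u.memLp_quotient.2.ne, v.memLp_quotient.2.ne⟩)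
        (eLpNorm_add_le u.memLp_quotient.1 v.memLp_quotient.1 hp.out)
    change (eLpNorm (u.fn + v.fn) q _).toReal + (gagliardo Ω s p (u.fn + v.fn)).toReal ≤
      ((eLpNorm u.fn q _).toReal + (gagliardo Ω s p u.fn).toReal) +
        ((eLpNorm v.fn q _).toReal + (gagliardo Ω s p v.fn).toReal)
    linarith

noncomputable instance [Fact (1 ≤ q)] [Fact (1 ≤ p)] : SeminormedAddCommGroup (C1 Ω s q p) :=
  SeminormedAddCommGroup.ofCore C1.core

noncomputable instance [Fact (1 ≤ q)] [Fact (1 ≤ p)] : NormedSpace ℝ (C1 Ω s q p) where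
  norm_smul_le c u := (C1.core.norm_smul c u).le

end C1

/-- The Banach space `M^{s;q,p}(Ω)`: the completion of the functions in `C¹(Ω)` of finite norm with
respect to the norm `‖u‖_{q,Ω} + [u]_{s,p,Ω}`. -/
abbrev M (Ω : Set (EuclideanSpace ℝ (Fin n))) (s : ℝ) (q p : ℝ≥0∞)
    [Fact (1 ≤ q)] [Fact (1 ≤ p)] : Type :=
  UniformSpace.Completion (C1 Ω s q p)

/-- The continuous linear map `ι` is the embedding of `M^{s;q,p}(Ω)` into `L^r(Ω)`: it is injective,
and it maps each function of the dense subspace to (the class of) this same function.  As this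
subspace is dense, there is at most one such `ι`. -/
def IsEmbedding {Ω : Set (EuclideanSpace ℝ (Fin n))} {s : ℝ} {q p r : ℝ≥0∞}
    [Fact (1 ≤ q)] [Fact (1 ≤ p)] [Fact (1 ≤ r)]
    (ι : M Ω s q p →L[ℝ] Lp ℝ r (volume.restrict Ω)) : Prop :=
  Function.Injective ι ∧
    ∀ u : C1 Ω s q p, (ι (u : M Ω s q p) : EuclideanSpace ℝ (Fin n) → ℝ) =ᵐ[volume.restrict Ω] u.fn

/-- `M^{s;q,p}(Ω)` is continuously embedded into `L^r(Ω)`. -/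
def ContinuouslyEmbeds (Ω : Set (EuclideanSpace ℝ (Fin n))) (s : ℝ) (q p r : ℝ≥0∞)
    [Fact (1 ≤ q)] [Fact (1 ≤ p)] [Fact (1 ≤ r)] : Prop :=
  ∃ ι : M Ω s q p →L[ℝ] Lp ℝ r (volume.restrict Ω), IsEmbedding ι

/-- `M^{s;q,p}(Ω)` is compactly embedded into `L^r(Ω)`. -/
def CompactlyEmbeds (Ω : Set (EuclideanSpace ℝ (Fin n))) (s : ℝ) (q p r : ℝ≥0∞)
    [Fact (1 ≤ q)] [Fact (1 ≤ p)] [Fact (1 ≤ r)] : Prop :=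
  ∃ ι : M Ω s q p →L[ℝ] Lp ℝ r (volume.restrict Ω), IsEmbedding ι ∧ IsCompactOperator ι

/-- The critical exponent `p*_s = n p / (n - s p)`, for `s p < n`. -/
noncomputable def criticalExponent (n : ℕ) (s : ℝ) (p : ℝ≥0∞) : ℝ≥0∞ :=
  (n * p) / (n - ENNReal.ofReal s * p)

end FracSobolev

/-! All estimates rest on measure density: `|B(x,ρ) ∩ Ω| ≥ c ρ^n` for `x ∈ Ω` and small `ρ`, which
holds because a point of a Lipschitz domain can be pushed into the interior along the graph
direction.

Sobolev inequality (`exists_eLpNorm_le`). Let `G(x)` be the `L^p` norm of the difference quotient in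
`y`, and let `t` be the critical exponent, so `n/t = n/p - s`. Comparing `u(x)` with its values on
`B(x,ρ) ∩ Ω` and using Hölder gives `|u(x)| ≤ A ρ^(-n/t) ‖u‖_t + B ρ^s G(x)`. Optimizing in `ρ`
yields `|u(x)| ≤ D ‖u‖_1 + E ‖u‖_t^θ G(x)^(1-θ)` with `θ = sp/n`. Since `(1-θ) t = p`, taking `L^t`
norms turns `G` into the seminorm by Tonelli, and `‖u‖_t^θ` is absorbed on the left. The absorption
needs `‖u‖_t < ∞`, which truncation provides.

Injectivity (`injective_of_eq_toLp`). The norm of `M` is carried by two limits, of the functions in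
`L^q` and of the difference quotients in `L^p(Ω × Ω)`. If the `L^r` limit is zero, a subsequence
tends to zero a.e., so both limits vanish.

Compactness (`compactlyEmbeds_of_bound`). Replacing `f` by means over balls of radius `h` is a
finite rank operation with `L^1` error at most `C h^s` times the seminorm. The embedding into `L^1`
is thus a norm limit of compact operators, and interpolation with a bounded embedding into some
`L^R`, `R > r`, gives compactness in `L^r`.

If `sp ≥ n`, the seminorm dominates one of order `σ` and finite exponent `P` with `σP < n` and
critical exponent above `r`, and the same argument applies. -/

/-! ### Interior balls and measure density. -/

theorem IsBoundedLipschitzDomain.exists_ball_subset {n : ℕ} {Ω : Set (EuclideanSpace ℝ (Fin n))}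
    (hΩ : IsBoundedLipschitzDomain Ω) :
    ∃ R > 0, ∃ δ > 0, ∀ x ∈ Ω, ∀ ρ, 0 < ρ → ρ ≤ R →
      ∃ y, Metric.ball y (δ * ρ) ⊆ Metric.ball x ρ ∩ Ω := by
  have hc : IsCompact (closure Ω) := hΩ.isBounded.isCompact_closure
  suffices h : ∃ R > 0, ∃ δ > 0, ∀ x ∈ closure Ω, x ∈ Ω → ∀ ρ, 0 < ρ → ρ ≤ R →
      ∃ y, Metric.ball y (δ * ρ) ⊆ Metric.ball x ρ ∩ Ω by
    obtain ⟨R, hR, δ, hδ, h⟩ := h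
    exact ⟨R, hR, δ, hδ, fun x hx => h x (subset_closure hx) hx⟩
  -- The property passes to subsets and finite unions, so compactness of the closure reduces it to a
  -- neighbourhood of each point.
  refine hc.induction_on (p := fun S => ∃ R > 0, ∃ δ > 0, ∀ x ∈ S, x ∈ Ω → ∀ ρ, 0 < ρ → ρ ≤ R →
      ∃ y, Metric.ball y (δ * ρ) ⊆ Metric.ball x ρ ∩ Ω) ?_ ?_ ?_ ?_
  · exact ⟨1, one_pos, 1, one_pos, by simp⟩
  · rintro S T hST ⟨R, hR, δ, hδ, h⟩
    exact ⟨R, hR, δ, hδ, fun x hx => h x (hST hx)⟩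
  · rintro S T ⟨R, hR, δ, hδ, h⟩ ⟨R', hR', δ', hδ', h'⟩
    refine ⟨min R R', lt_min hR hR', min δ δ', lt_min hδ hδ', ?_⟩
    rintro x (hx | hx) hxΩ ρ hρ hρR
    · obtain ⟨y, hy⟩ := h x hx hxΩ ρ hρ (hρR.trans (min_le_left _ _))
      exact ⟨y, (Metric.ball_subset_ball (by gcongr; exact min_le_left _ _)).trans hy⟩
    · obtain ⟨y, hy⟩ := h' x hx hxΩ ρ hρ (hρR.trans (min_le_right _ _))
      exact ⟨y, (Metric.ball_subset_ball (by gcongr; exact min_le_right _ _)).trans hy⟩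
  · intro z hz
    by_cases hzΩ : z ∈ Ω
    · obtain ⟨r, hr, hball⟩ := Metric.isOpen_iff.1 hΩ.isOpen z hzΩ
      refine ⟨Metric.ball z (r / 2), mem_nhdsWithin_of_mem_nhds (Metric.ball_mem_nhds _ (by positivity)),
        r / 2, by positivity, 1, one_pos, ?_⟩
      intro x hx _ ρ hρ hρR
      refine ⟨x, Set.subset_inter (by simp) fun w hw => hball ?_⟩
      rw [Metric.mem_ball] at *
      linarith [dist_triangle w x z]
    · have hzf : z ∈ frontier Ω := by
        rw [hΩ.isOpen.frontier_eq]
        exact ⟨hz, hzΩ⟩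
      obtain ⟨e, he, φ, ⟨K, hK⟩, r, hr, hgraph⟩ := hΩ.lipschitz_boundary z hzf
      set P := (Submodule.span ℝ {e})ᗮ.orthogonalProjectionOnto with hP
      refine ⟨Metric.ball z (r / 2), mem_nhdsWithin_of_mem_nhds (Metric.ball_mem_nhds _ (by positivity)),
        r / 2, by positivity, 1 / (2 * (K + 1)), by positivity, ?_⟩
      intro x hx hxΩ ρ hρ hρR
      have hK0 : (0 : ℝ) ≤ K := K.2
      have hxr : dist x z < r / 2 := hx
      have hδ : 1 / (2 * ((K : ℝ) + 1)) * ρ * (K + 1) = ρ / 2 := by field_simp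
      set η := 1 / (2 * ((K : ℝ) + 1)) * ρ with hη
      have hη0 : 0 < η := by positivity
      -- Moving by `(ρ/2) e` gains height `ρ/2` over the graph. A perturbation `v` costs at most
      -- `‖v‖` in height and `K ‖v‖` in the graph, and `(K + 1) η = ρ/2`. Both `x` and `ρ` are
      -- limited by `r/2` so that everything stays where the graph describes `Ω`.
      refine ⟨x + (ρ / 2) • e, fun y hy => ?_⟩
      obtain ⟨v, rfl⟩ : ∃ v, y = x + (ρ / 2) • e + v := ⟨y - (x + (ρ / 2) • e), by abel⟩
      have hv : ‖v‖ < η := by simpa [Metric.mem_ball, dist_eq_norm] using hy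
      have hdist : dist (x + (ρ / 2) • e + v) x < ρ := by
        rw [dist_eq_norm, show x + (ρ / 2) • e + v - x = (ρ / 2) • e + v by abel]
        refine (norm_add_le _ _).trans_lt ?_
        rw [norm_smul, he, Real.norm_of_nonneg (by positivity)]
        nlinarith
      refine ⟨hdist, ?_⟩
      rw [hgraph _ (by rw [Metric.mem_ball]; linarith [dist_triangle (x + (ρ / 2) • e + v) x z])]
      have hx' := (hgraph x (by rw [Metric.mem_ball]; linarith)).1 hxΩ
      have hPe : P e = 0 := by
        rw [hP, Submodule.orthogonalProjectionOnto_eq_zero_iff,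
          Submodule.orthogonal_orthogonal]
        exact Submodule.mem_span_singleton_self e
      have hPy : P (x + (ρ / 2) • e + v) = P x + P v := by
        simp [map_add, map_smul, hPe]
      have hPv : ‖P v‖ ≤ ‖v‖ := Submodule.norm_orthogonalProjectionOnto_apply_le _ v
      have hφ : φ (P x + P v) ≤ φ (P x) + K * ‖P v‖ := by
        have := hK.dist_le_mul (P x + P v) (P x)
        rw [Real.dist_eq, dist_eq_norm, add_sub_cancel_left] at this
        linarith [le_abs_self (φ (P x + P v) - φ (P x))]
      have hin : ⟪e, x + (ρ / 2) • e + v⟫ = ⟪e, x⟫ + ρ / 2 + ⟪e, v⟫ := by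
        rw [inner_add_right, inner_add_right, inner_smul_right, real_inner_self_eq_norm_sq, he]
        ring
      have hev : -‖v‖ ≤ ⟪e, v⟫ := by
        have := abs_real_inner_le_norm e v
        rw [he, one_mul] at this
        exact (abs_le.1 this).1
      rw [hPy, hin]
      nlinarith [mul_le_mul_of_nonneg_left hPv hK0]

/-- The interior ball of radius `δρ` already has volume a constant times `ρ^n`. This is the only
consequence of boundary regularity used below. -/
theorem IsBoundedLipschitzDomain.exists_volume_ball_ge {n : ℕ}
    {Ω : Set (EuclideanSpace ℝ (Fin n))} (hΩ : IsBoundedLipschitzDomain Ω) :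
    ∃ R > 0, ∃ c > 0, ∀ x ∈ Ω, ∀ ρ, 0 < ρ → ρ ≤ R →
      ENNReal.ofReal (c * ρ ^ n) ≤ volume.restrict Ω (Metric.ball x ρ) := by
  obtain ⟨R, hR, δ, hδ, h⟩ := hΩ.exists_ball_subset
  have h1 : 0 < (volume (Metric.ball (0 : EuclideanSpace ℝ (Fin n)) 1)).toReal :=
    ENNReal.toReal_pos (Metric.measure_ball_pos _ _ one_pos).ne' measure_ball_lt_top.ne
  refine ⟨R, hR, δ ^ n * (volume (Metric.ball (0 : EuclideanSpace ℝ (Fin n)) 1)).toReal,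
    by positivity, fun x hx ρ hρ hρR => ?_⟩
  obtain ⟨y, hy⟩ := h x hx ρ hρ hρR
  rw [Measure.restrict_apply measurableSet_ball]
  refine le_trans (le_of_eq ?_) (measure_mono hy)
  rw [Measure.addHaar_ball_of_pos volume y (show 0 < δ * ρ by positivity), finrank_euclideanSpace_fin,
    show δ ^ n * (volume (Metric.ball (0 : EuclideanSpace ℝ (Fin n)) 1)).toReal * ρ ^ n =
      (δ * ρ) ^ n * (volume (Metric.ball (0 : EuclideanSpace ℝ (Fin n)) 1)).toReal by ring,
    ENNReal.ofReal_mul (by positivity), ENNReal.ofReal_toReal measure_ball_lt_top.ne]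

theorem IsBoundedLipschitzDomain.isFiniteMeasure {n : ℕ} {Ω : Set (EuclideanSpace ℝ (Fin n))}
    (hΩ : IsBoundedLipschitzDomain Ω) : IsFiniteMeasure (volume.restrict Ω) :=
  isFiniteMeasure_restrict.2 hΩ.isBounded.measure_lt_top.ne

/-! ### Extension to the completion and injectivity. -/

namespace FracSobolev

open Filter Topology

variable {n : ℕ} {Ω : Set (EuclideanSpace ℝ (Fin n))} {s : ℝ} {q p r : ℝ≥0∞}

theorem C1.norm_def (u : C1 Ω s q p) :
    ‖u‖ = (eLpNorm u.fn q (volume.restrict Ω)).toReal + (gagliardo Ω s p u.fn).toReal := rfl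

theorem C1.fn_add (u v : C1 Ω s q p) : (u + v).fn = u.fn + v.fn := rfl

theorem C1.fn_smul (c : ℝ) (u : C1 Ω s q p) : (c • u).fn = c • u.fn := rfl

section Fact

variable [Fact (1 ≤ q)] [Fact (1 ≤ p)] [Fact (1 ≤ r)]

/-- A bounded linear map into a Banach space extends to the completion. -/
theorem exists_extension {E F : Type*} [SeminormedAddCommGroup E] [NormedSpace ℝ E]
    [NormedAddCommGroup F] [NormedSpace ℝ F] [CompleteSpace F]
    (T : E →ₗ[ℝ] F) (C : ℝ) (hT : ∀ u, ‖T u‖ ≤ C * ‖u‖) :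
    ∃ L : UniformSpace.Completion E →L[ℝ] F, ∀ u : E, L u = T u := by
  let e : E →ₗ[ℝ] UniformSpace.Completion E :=
    (UniformSpace.Completion.toComplL (𝕜 := ℝ) (E := E)).toLinearMap
  have he : ∀ u, e u = (u : UniformSpace.Completion E) := fun u => rfl
  refine ⟨T.extendOfNorm e, fun u => ?_⟩
  rw [← he]
  exact LinearMap.extendOfNorm_eq UniformSpace.Completion.denseRange_coe
    ⟨C, fun v => by rw [he, UniformSpace.Completion.norm_coe]; exact hT v⟩ u

/-- The inclusion of the functions in `C¹` into `L^r`. -/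
noncomputable def C1.toLp (h : ∀ u : C1 Ω s q p, MemLp u.fn r (volume.restrict Ω)) :
    C1 Ω s q p →ₗ[ℝ] Lp ℝ r (volume.restrict Ω) where
  toFun u := (h u).toLp u.fn
  map_add' _ _ := rfl
  map_smul' _ _ := rfl

/-- The difference quotient as a linear map into `L^p(Ω × Ω)`. -/
noncomputable def C1.quotientLp :
    C1 Ω s q p →ₗ[ℝ] Lp ℝ p ((volume.restrict Ω).prod (volume.restrict Ω)) where
  toFun u := u.memLp_quotient.toLp (quotient s p u.fn)
  map_add' u v := by
    rw [← MemLp.toLp_add]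
    exact MemLp.toLp_congr _ _ (by rw [C1.fn_add, quotient_add])
  map_smul' c u := by
    rw [RingHom.id_apply, ← MemLp.toLp_const_smul]
    exact MemLp.toLp_congr _ _ (by rw [C1.fn_smul, quotient_smul])

/-- Norm convergence and, on a finite measure, a.e. convergence both imply convergence in measure,
whose limit is unique a.e. -/
theorem eq_zero_of_tendsto {α : Type*} [MeasurableSpace α] {μ : Measure α} [IsFiniteMeasure μ]
    {f : ℕ → Lp ℝ r μ} {g : Lp ℝ r μ} (hf : Tendsto f atTop (𝓝 g))
    (h0 : ∀ᵐ x ∂μ, Tendsto (fun k => f k x) atTop (𝓝 0)) : g = 0 := by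
  have h1 := tendstoInMeasure_of_tendsto_Lp hf
  have h2 : TendstoInMeasure μ (fun k => (f k : α → ℝ)) atTop (fun _ => 0) :=
    tendstoInMeasure_of_tendsto_ae (fun k => Lp.aestronglyMeasurable _) h0
  exact (Lp.eq_zero_iff_ae_eq_zero).2 (tendstoInMeasure_ae_unique h1 h2)

/-- A bounded extension of the inclusion `C¹ → L^r` is injective. -/
theorem injective_of_eq_toLp [IsFiniteMeasure (volume.restrict Ω)]
    (h : ∀ u : C1 Ω s q p, MemLp u.fn r (volume.restrict Ω))
    (L : M Ω s q p →L[ℝ] Lp ℝ r (volume.restrict Ω))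
    (hL : ∀ u : C1 Ω s q p, L (u : M Ω s q p) = C1.toLp h u) : Function.Injective L := by
  obtain ⟨A, hA⟩ := exists_extension (C1.toLp (fun u : C1 Ω s q p => u.memLp)) 1 (fun u => by
    rw [one_mul, C1.norm_def]
    change ‖(u.memLp.toLp u.fn)‖ ≤ _
    rw [Lp.norm_toLp]
    exact le_add_of_nonneg_right ENNReal.toReal_nonneg)
  obtain ⟨B, hB⟩ := exists_extension (C1.quotientLp (Ω := Ω) (s := s) (q := q) (p := p)) 1
    (fun u => by
      rw [one_mul, C1.norm_def]
      change ‖(u.memLp_quotient.toLp _)‖ ≤ _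
      rw [Lp.norm_toLp]
      exact le_add_of_nonneg_left ENNReal.toReal_nonneg)
  -- Both sides are continuous and agree on the dense subspace; hence an element killed by `A` and
  -- `B` is zero.
  have hnorm : ∀ x : M Ω s q p, ‖x‖ = ‖A x‖ + ‖B x‖ := fun x => by
    induction x using UniformSpace.Completion.induction_on with
    | hp => exact isClosed_eq (by fun_prop) (by fun_prop)
    | ih u =>
      rw [UniformSpace.Completion.norm_coe, hA, hB, C1.norm_def]
      change _ = ‖(u.memLp.toLp u.fn)‖ + ‖(u.memLp_quotient.toLp _)‖
      rw [Lp.norm_toLp, Lp.norm_toLp]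
      rfl
  rw [injective_iff_map_eq_zero]
  intro x hx
  obtain ⟨w, hw, hwx⟩ := mem_closure_iff_seq_limit.1
    (UniformSpace.Completion.denseRange_coe (α := C1 Ω s q p) x)
  choose v hv using hw
  obtain rfl : (fun k => (v k : M Ω s q p)) = w := funext hv
  have hae : ∀ {t : ℝ≥0∞} [Fact (1 ≤ t)] (ht : ∀ u : C1 Ω s q p, MemLp u.fn t (volume.restrict Ω)),
      ∀ᵐ y ∂volume.restrict Ω, ∀ k, C1.toLp ht (v k) y = (v k).fn y := fun ht =>
    ae_all_iff.2 fun k => (ht (v k)).coeFn_toLp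
  have hLv : Tendsto (fun k => C1.toLp h (v k)) atTop (𝓝 0) := by
    have := (L.continuous.tendsto x).comp hwx
    rw [hx] at this
    simpa only [Function.comp_def, hL] using this
  obtain ⟨φ, hφ, hlim⟩ := (tendstoInMeasure_of_tendsto_Lp hLv).exists_seq_tendsto_ae
  have hlim' : ∀ᵐ y ∂volume.restrict Ω, Tendsto (fun k => (v (φ k)).fn y) atTop (𝓝 0) := by
    filter_upwards [hlim, hae h, Lp.coeFn_zero ℝ r (volume.restrict Ω)] with y hy hy' hy0
    simpa only [hy', hy0, Pi.zero_apply] using hy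
  have hxφ := hwx.comp hφ.tendsto_atTop
  have hA0 : A x = 0 := by
    refine eq_zero_of_tendsto ((A.continuous.tendsto x).comp hxφ) ?_
    filter_upwards [hlim', hae (fun u => u.memLp)] with y hy hy'
    simpa only [Function.comp_def, hA, hy'] using hy
  -- The quotients tend to zero at every pair of points at which the functions do, hence a.e. in the
  -- product.
  have hB0 : B x = 0 := by
    refine eq_zero_of_tendsto ((B.continuous.tendsto x).comp hxφ) ?_
    have hq : ∀ᵐ z ∂(volume.restrict Ω).prod (volume.restrict Ω),
        ∀ k, C1.quotientLp (v k) z = quotient s p (v k).fn z :=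
      ae_all_iff.2 fun k => (v k).memLp_quotient.coeFn_toLp
    filter_upwards [hq, Measure.quasiMeasurePreserving_fst.ae hlim',
      Measure.quasiMeasurePreserving_snd.ae hlim'] with z hz h1 h2
    simp only [Function.comp_def, hB, hz, quotient]
    simpa using (h1.sub h2).div_const _
  rw [← norm_eq_zero, hnorm, hA0, hB0, norm_zero, norm_zero, add_zero]

/-- Bounded inclusions of the functions in `C¹` into `L^r` extend to embeddings of `M`. -/
theorem continuouslyEmbeds_of_bound [IsFiniteMeasure (volume.restrict Ω)] (C : ℝ≥0)
    (h : ∀ u : C1 Ω s q p, eLpNorm u.fn r (volume.restrict Ω) ≤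
      C * (eLpNorm u.fn q (volume.restrict Ω) + gagliardo Ω s p u.fn)) :
    ContinuouslyEmbeds Ω s q p r := by
  have htop : ∀ u : C1 Ω s q p,
      eLpNorm u.fn q (volume.restrict Ω) + gagliardo Ω s p u.fn ≠ ∞ := fun u =>
    ENNReal.add_ne_top.2 ⟨u.memLp.2.ne, u.memLp_quotient.2.ne⟩
  have hmem : ∀ u : C1 Ω s q p, MemLp u.fn r (volume.restrict Ω) := fun u =>
    ⟨u.memLp.1, (h u).trans_lt (ENNReal.mul_lt_top ENNReal.coe_lt_top (htop u).lt_top)⟩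
  obtain ⟨L, hL⟩ := exists_extension (C1.toLp hmem) C (fun u => by
    change ‖((hmem u).toLp u.fn)‖ ≤ _
    have hg : gagliardo Ω s p u.fn ≠ ∞ := u.memLp_quotient.2.ne
    rw [Lp.norm_toLp, C1.norm_def, ← ENNReal.toReal_add u.memLp.2.ne hg]
    have := ENNReal.toReal_mono (ENNReal.mul_ne_top ENNReal.coe_ne_top (htop u)) (h u)
    rwa [ENNReal.toReal_mul] at this)
  exact ⟨L, injective_of_eq_toLp hmem L hL, fun u => by rw [hL]; exact (hmem u).coeFn_toLp⟩

end Fact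

end FracSobolev

/-! ### Pointwise comparison with means, and two real inequalities. -/

namespace FracSobolev

open Filter Topology

variable {n : ℕ} {s : ℝ} {p t : ℝ≥0∞}

theorem enorm_sub_le_mul_enorm_quotient (hs : 0 ≤ s) (u : EuclideanSpace ℝ (Fin n) → ℝ) {d : ℝ}
    {x y : EuclideanSpace ℝ (Fin n)} (hd : ‖x - y‖ ≤ d) :
    ‖u x - u y‖ₑ ≤ ENNReal.ofReal (d ^ ((n : ℝ) / p.toReal + s)) * ‖quotient s p u (x, y)‖ₑ := by
  have ha : 0 ≤ (n : ℝ) / p.toReal + s := by positivity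
  have h : |u x - u y| = ‖x - y‖ ^ ((n : ℝ) / p.toReal + s) * |quotient s p u (x, y)| := by
    rcases eq_or_ne x y with rfl | hxy
    · simp [quotient]
    · have : 0 < ‖x - y‖ ^ ((n : ℝ) / p.toReal + s) :=
        Real.rpow_pos_of_pos (norm_pos_iff.2 (sub_ne_zero.2 hxy)) _
      simp only [quotient, abs_div, abs_of_pos this]
      field_simp
  rw [Real.enorm_eq_ofReal_abs, Real.enorm_eq_ofReal_abs,
    ← ENNReal.ofReal_mul (Real.rpow_nonneg ((norm_nonneg _).trans hd) _), h]
  gcongr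

theorem aestronglyMeasurable_quotient_right {μ : Measure (EuclideanSpace ℝ (Fin n))}
    {u : EuclideanSpace ℝ (Fin n) → ℝ} (hu : AEStronglyMeasurable u μ)
    (x : EuclideanSpace ℝ (Fin n)) :
    AEStronglyMeasurable (fun y => quotient s p u (x, y)) μ := by
  have h : Measurable fun y : EuclideanSpace ℝ (Fin n) =>
      ‖x - y‖ ^ ((n : ℝ) / p.toReal + s) := by fun_prop
  exact ((aemeasurable_const (b := u x) |>.sub hu.aemeasurable).div h.aemeasurable).aestronglyMeasurable

theorem aestronglyMeasurable_quotient {μ : Measure (EuclideanSpace ℝ (Fin n))} [SFinite μ]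
    {u : EuclideanSpace ℝ (Fin n) → ℝ} (hu : AEStronglyMeasurable u μ) :
    AEStronglyMeasurable (quotient s p u) (μ.prod μ) := by
  have h : Measurable fun z : EuclideanSpace ℝ (Fin n) × EuclideanSpace ℝ (Fin n) =>
      ‖z.1 - z.2‖ ^ ((n : ℝ) / p.toReal + s) := by fun_prop
  exact ((hu.aemeasurable.comp_quasiMeasurePreserving Measure.quasiMeasurePreserving_fst).sub
    (hu.aemeasurable.comp_quasiMeasurePreserving Measure.quasiMeasurePreserving_snd)).div
      h.aemeasurable |>.aestronglyMeasurable

/-- The mean oscillation of `u` about `u x` on a set `B` near `x` is controlled by the `L^p` norm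
of the difference quotient. -/
theorem setLIntegral_enorm_sub_le (hs : 0 ≤ s) (hp : 1 ≤ p)
    {μ : Measure (EuclideanSpace ℝ (Fin n))}
    {u : EuclideanSpace ℝ (Fin n) → ℝ} (hu : AEStronglyMeasurable u μ)
    {B : Set (EuclideanSpace ℝ (Fin n))} (hB : MeasurableSet B) {d : ℝ}
    {x : EuclideanSpace ℝ (Fin n)} (hd : ∀ y ∈ B, ‖x - y‖ ≤ d) :
    ∫⁻ y in B, ‖u x - u y‖ₑ ∂μ ≤ ENNReal.ofReal (d ^ ((n : ℝ) / p.toReal + s)) *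
      (eLpNorm (fun y => quotient s p u (x, y)) p μ * μ B ^ (1 - 1 / p.toReal)) := by
  calc ∫⁻ y in B, ‖u x - u y‖ₑ ∂μ
      ≤ ∫⁻ y in B, ENNReal.ofReal (d ^ ((n : ℝ) / p.toReal + s)) * ‖quotient s p u (x, y)‖ₑ ∂μ :=
        setLIntegral_mono' hB fun y hy => enorm_sub_le_mul_enorm_quotient hs u (hd y hy)
    _ = ENNReal.ofReal (d ^ ((n : ℝ) / p.toReal + s)) *
          eLpNorm (fun y => quotient s p u (x, y)) 1 (μ.restrict B) := by
        rw [lintegral_const_mul' _ _ ENNReal.ofReal_ne_top, eLpNorm_one_eq_lintegral_enorm]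
    _ ≤ _ := by
        gcongr
        have := eLpNorm_le_eLpNorm_mul_rpow_measure_univ hp
          ((aestronglyMeasurable_quotient_right (s := s) (p := p) hu x).restrict (s := B))
        rw [Measure.restrict_apply_univ, ENNReal.toReal_one, div_one] at this
        refine this.trans ?_
        gcongr
        exact Measure.restrict_le_self

/-- Hölder on `B` followed by division by the measure `a` of `B` leaves `a ^ (1 - e) / a`; a lower
bound on the measure is enough to control it. -/
theorem ofReal_rpow_neg_mul {a : ℝ≥0∞} {m e : ℝ} (hm : 0 < m) (hma : ENNReal.ofReal m ≤ a)
    (ha : a ≠ ∞) (he : 0 ≤ e) : a ^ (1 - e) / a ≤ ENNReal.ofReal (m ^ (-e)) := by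
  have ha0 : a ≠ 0 := ((ENNReal.ofReal_pos.2 hm).trans_le hma).ne'
  rw [← ENNReal.ofReal_rpow_of_pos hm, ENNReal.div_eq_inv_mul, ← ENNReal.rpow_neg_one,
    ← ENNReal.rpow_add _ _ ha0 ha, show -1 + (1 - e) = -e by ring,
    ENNReal.rpow_neg, ENNReal.rpow_neg]
  exact ENNReal.inv_le_inv.2 (ENNReal.rpow_le_rpow hma he)

/-- Comparison of `u x` with the mean of `u` on a set `B` near `x`. -/
theorem enorm_le_eLpNorm_add_eLpNorm_quotient (hs : 0 ≤ s) (hp : 1 ≤ p) (ht : 1 ≤ t)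
    {μ : Measure (EuclideanSpace ℝ (Fin n))} [IsFiniteMeasure μ]
    {u : EuclideanSpace ℝ (Fin n) → ℝ} (hu : AEStronglyMeasurable u μ)
    {B : Set (EuclideanSpace ℝ (Fin n))} (hB : MeasurableSet B) {d m : ℝ} (hd0 : 0 ≤ d)
    (hm : 0 < m) (hmB : ENNReal.ofReal m ≤ μ B)
    {x : EuclideanSpace ℝ (Fin n)} (hd : ∀ y ∈ B, ‖x - y‖ ≤ d) :
    ‖u x‖ₑ ≤ ENNReal.ofReal (m ^ (-(1 / t.toReal))) * eLpNorm u t μ +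
      ENNReal.ofReal (d ^ ((n : ℝ) / p.toReal + s) * m ^ (-(1 / p.toReal))) *
        eLpNorm (fun y => quotient s p u (x, y)) p μ := by
  have hB0 : μ B ≠ 0 := ((ENNReal.ofReal_pos.2 hm).trans_le hmB).ne'
  have hBt : μ B ≠ ∞ := measure_ne_top _ _
  -- Integrating `|u(x)| ≤ |u(y)| + |u(x) - u(y)|` in `[0, ∞]` avoids any integrability assumption
  -- on `u`.
  have h1 : ‖u x‖ₑ * μ B ≤ ∫⁻ y in B, ‖u y‖ₑ ∂μ + ∫⁻ y in B, ‖u x - u y‖ₑ ∂μ := by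
    rw [← setLIntegral_const, ← lintegral_add_left' hu.enorm.restrict]
    refine lintegral_mono fun y => ?_
    calc ‖u x‖ₑ = ‖u y + (u x - u y)‖ₑ := by rw [add_sub_cancel]
      _ ≤ _ := enorm_add_le _ _
  have h2 : ∫⁻ y in B, ‖u y‖ₑ ∂μ ≤ eLpNorm u t μ * μ B ^ (1 - 1 / t.toReal) := by
    have := eLpNorm_le_eLpNorm_mul_rpow_measure_univ ht (hu.restrict (s := B))
    rw [Measure.restrict_apply_univ, ENNReal.toReal_one, div_one,
      eLpNorm_one_eq_lintegral_enorm] at this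
    refine this.trans ?_
    gcongr
    exact Measure.restrict_le_self
  have h3 := setLIntegral_enorm_sub_le hs hp hu hB hd
  have h4 := ofReal_rpow_neg_mul (e := 1 / t.toReal) hm hmB hBt (by positivity)
  have h5 := ofReal_rpow_neg_mul (e := 1 / p.toReal) hm hmB hBt (by positivity)
  calc ‖u x‖ₑ ≤ (eLpNorm u t μ * μ B ^ (1 - 1 / t.toReal) +
        ENNReal.ofReal (d ^ ((n : ℝ) / p.toReal + s)) *
          (eLpNorm (fun y => quotient s p u (x, y)) p μ * μ B ^ (1 - 1 / p.toReal))) / μ B := by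
        rw [ENNReal.le_div_iff_mul_le (Or.inl hB0) (Or.inl hBt)]
        exact h1.trans (add_le_add h2 h3)
    _ = μ B ^ (1 - 1 / t.toReal) / μ B * eLpNorm u t μ +
        ENNReal.ofReal (d ^ ((n : ℝ) / p.toReal + s)) * (μ B ^ (1 - 1 / p.toReal) / μ B) *
          eLpNorm (fun y => quotient s p u (x, y)) p μ := by
        simp only [div_eq_mul_inv]
        ring
    _ ≤ _ := by
        rw [ENNReal.ofReal_mul (Real.rpow_nonneg hd0 _)]
        gcongr

theorem lintegral_eLpNorm_quotient_rpow {P : ℝ} (hP : 0 < P)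
    {μ : Measure (EuclideanSpace ℝ (Fin n))} [SFinite μ]
    {u : EuclideanSpace ℝ (Fin n) → ℝ} (hu : AEStronglyMeasurable u μ) :
    ∫⁻ x, eLpNorm (fun y => quotient s (ENNReal.ofReal P) u (x, y)) (ENNReal.ofReal P) μ ^ P ∂μ =
      eLpNorm (quotient s (ENNReal.ofReal P) u) (ENNReal.ofReal P) (μ.prod μ) ^ P := by
  have hP0 : ENNReal.ofReal P ≠ 0 := (ENNReal.ofReal_pos.2 hP).ne'
  simp only [eLpNorm_eq_lintegral_rpow_enorm_toReal hP0 ENNReal.ofReal_ne_top,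
    ENNReal.toReal_ofReal hP.le, one_div, ENNReal.rpow_inv_rpow hP.ne']
  rw [lintegral_prod _ ((aestronglyMeasurable_quotient hu).enorm.pow_const _)]

theorem aemeasurable_eLpNorm_quotient {P : ℝ} (hP : 0 < P)
    {μ : Measure (EuclideanSpace ℝ (Fin n))} [SFinite μ]
    {u : EuclideanSpace ℝ (Fin n) → ℝ} (hu : AEStronglyMeasurable u μ) :
    AEMeasurable (fun x => eLpNorm (fun y => quotient s (ENNReal.ofReal P) u (x, y))
      (ENNReal.ofReal P) μ) μ := by
  have hP0 : ENNReal.ofReal P ≠ 0 := (ENNReal.ofReal_pos.2 hP).ne'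
  simp only [eLpNorm_eq_lintegral_rpow_enorm_toReal hP0 ENNReal.ofReal_ne_top]
  exact ((aestronglyMeasurable_quotient hu).enorm.pow_const _).lintegral_prod_right'.pow_const _

/-- Optimization in the radius. -/
theorem le_of_forall_radius {ν P A B D R N L G a : ℝ} (hν : 0 < ν) (hP : 0 < P) (hs : 0 < s)
    (hsP : s * P < ν) (hA : 0 ≤ A) (hB : 0 ≤ B) (hD : 0 ≤ D) (hR : 0 < R) (hN : 0 < N)
    (hL : 0 ≤ L) (hG : 0 ≤ G)
    (h1 : ∀ ρ, 0 < ρ → ρ ≤ R → a ≤ A * ρ ^ (-(ν / P - s)) * N + B * ρ ^ s * G)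
    (h2 : a ≤ D * L + B * R ^ s * G) :
    a ≤ D * L + (A + B) * (N ^ (s * P / ν) * G ^ (1 - s * P / ν)) := by
  have hθ : s * P / ν < 1 := (div_lt_one hν).2 hsP
  rcases hG.eq_or_lt with rfl | hG
  · rw [Real.zero_rpow (by linarith)]
    simpa using h2
  -- The radius at which `ρ^(-(ν/P - s)) N` and `ρ^s G` coincide.
  set ρ := (N / G) ^ (P / ν) with hρ
  have hNG : 0 < N / G := div_pos hN hG
  have hρ0 : 0 < ρ := Real.rpow_pos_of_pos hNG _
  have e2 : ρ ^ s * G = N ^ (s * P / ν) * G ^ (1 - s * P / ν) := by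
    rw [hρ, ← Real.rpow_mul hNG.le, show P / ν * s = s * P / ν by ring,
      Real.div_rpow hN.le hG.le, Real.rpow_sub hG, Real.rpow_one]
    field_simp
  have e1 : ρ ^ (-(ν / P - s)) * N = N ^ (s * P / ν) * G ^ (1 - s * P / ν) := by
    rw [hρ, ← Real.rpow_mul hNG.le, show P / ν * (-(ν / P - s)) = s * P / ν - 1 by field_simp; ring,
      Real.div_rpow hN.le hG.le, Real.rpow_sub hN, Real.rpow_sub hG, Real.rpow_sub hG,
      Real.rpow_one, Real.rpow_one]
    field_simp
  rcases le_or_gt ρ R with h | h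
  · have := h1 ρ hρ0 h
    rw [mul_assoc, mul_assoc, e1, e2] at this
    nlinarith [mul_nonneg hD hL]
  -- The balancing radius is not admissible; the bound at radius `R` serves instead, its second term
  -- being below the balanced value.
  · have h3 : R ^ s * G ≤ ρ ^ s * G := by gcongr
    rw [e2] at h3
    have h4 : 0 ≤ N ^ (s * P / ν) * G ^ (1 - s * P / ν) := by positivity
    rw [mul_assoc] at h2
    nlinarith [mul_le_mul_of_nonneg_left h3 hB, mul_nonneg hA h4]

/-- Absorption of the interpolated term. -/
theorem le_of_le_add_interpolation {θ D E N L Γ : ℝ} (hθ1 : θ < 1) (hD : 0 ≤ D)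
    (hE : 0 ≤ E) (hN : 0 < N) (hL : 0 ≤ L) (hΓ : 0 ≤ Γ)
    (h : N ≤ D * L + E * (N ^ θ * Γ ^ (1 - θ))) :
    N ≤ (2 * D + (2 * E) ^ (1 / (1 - θ))) * (L + Γ) := by
  have hθ : 0 < 1 - θ := by linarith
  have hE' : 0 ≤ (2 * E) ^ (1 / (1 - θ)) := by positivity
  have h1 : 0 ≤ D * Γ := by positivity
  have h2 : 0 ≤ D * L := by positivity
  have h3 : 0 ≤ (2 * E) ^ (1 / (1 - θ)) * L := by positivity
  have h4 : 0 ≤ (2 * E) ^ (1 / (1 - θ)) * Γ := by positivity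
  -- Otherwise `D L < N/2`, so the interpolated term exceeds `N/2` and division by `N^θ` is
  -- possible.
  rcases le_or_gt N (2 * (D * L)) with hle | hlt
  · nlinarith
  · have h5 : N ≤ 2 * E * Γ ^ (1 - θ) * N ^ θ := by nlinarith
    have h6 : N ^ (1 - θ) ≤ 2 * E * Γ ^ (1 - θ) := by
      rw [Real.rpow_sub hN, Real.rpow_one, div_le_iff₀ (Real.rpow_pos_of_pos hN _)]
      exact h5
    have h7 : N ≤ (2 * E) ^ (1 / (1 - θ)) * Γ := by
      have := Real.rpow_le_rpow (by positivity) h6 (show 0 ≤ 1 / (1 - θ) by positivity)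
      rwa [Real.mul_rpow (by positivity) (by positivity), ← Real.rpow_mul hN.le,
        ← Real.rpow_mul hΓ, mul_one_div_cancel hθ.ne', Real.rpow_one, Real.rpow_one] at this
    nlinarith

end FracSobolev

/-! ### The Sobolev inequality at the critical exponent. -/

namespace FracSobolev

open Filter Topology

variable {n : ℕ} {s : ℝ}

theorem ofReal_one_le {P : ℝ} (hP : 1 ≤ P) : 1 ≤ ENNReal.ofReal P := by
  simpa using ENNReal.ofReal_le_ofReal hP

/-- The comparison with means is used with exponent `t` at all radii up to `R`, and with exponent
`1` at radius `R` as the fallback. Since `n/t = n/P - s`, `le_of_forall_radius` applies. -/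
theorem enorm_le_interpolation (hn : 0 < n) {P R c t : ℝ} (hP : 1 ≤ P) (hs : 0 < s)
    (hsP : s * P < n) (hR : 0 < R) (hc : 0 < c) (ht : t = n * P / (n - s * P)) (ht1 : 1 ≤ t)
    {μ : Measure (EuclideanSpace ℝ (Fin n))} [IsFiniteMeasure μ]
    {x : EuclideanSpace ℝ (Fin n)}
    (hμ : ∀ ρ, 0 < ρ → ρ ≤ R → ENNReal.ofReal (c * ρ ^ n) ≤ μ (Metric.ball x ρ))
    {u : EuclideanSpace ℝ (Fin n) → ℝ} (hu : AEStronglyMeasurable u μ)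
    (hN0 : eLpNorm u (ENNReal.ofReal t) μ ≠ 0) (hN : eLpNorm u (ENNReal.ofReal t) μ ≠ ∞)
    (hL : eLpNorm u 1 μ ≠ ∞) :
    ‖u x‖ₑ ≤ ENNReal.ofReal ((c * R ^ n) ^ (-1 : ℝ)) * eLpNorm u 1 μ +
      ENNReal.ofReal (c ^ (-(1 / t)) + c ^ (-(1 / P))) *
        (eLpNorm u (ENNReal.ofReal t) μ ^ (s * P / n) *
          eLpNorm (fun y => quotient s (ENNReal.ofReal P) u (x, y)) (ENNReal.ofReal P) μ ^
            (1 - s * P / n)) := by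
  have hν : (0 : ℝ) < n := by exact_mod_cast hn
  have hP0 : 0 < P := by linarith
  have ht0 : 0 < t := by linarith
  have hθ : s * P / n < 1 := (div_lt_one hν).2 hsP
  have hA : 0 < c ^ (-(1 / t)) := by positivity
  have hB : 0 < c ^ (-(1 / P)) := by positivity
  have key : ∀ {τ : ℝ}, 1 ≤ τ → ∀ ρ, 0 < ρ → ρ ≤ R →
      ‖u x‖ₑ ≤ ENNReal.ofReal ((c * ρ ^ n) ^ (-(1 / τ))) * eLpNorm u (ENNReal.ofReal τ) μ +
        ENNReal.ofReal (c ^ (-(1 / P)) * ρ ^ s) *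
        eLpNorm (fun y => quotient s (ENNReal.ofReal P) u (x, y)) (ENNReal.ofReal P) μ := by
    intro τ hτ ρ hρ hρR
    have := enorm_le_eLpNorm_add_eLpNorm_quotient (x := x) hs.le (ofReal_one_le hP)
      (ofReal_one_le hτ) hu (Metric.isOpen_ball.measurableSet) hρ.le (by positivity) (hμ ρ hρ hρR)
      (fun y hy => by rw [← dist_eq_norm, dist_comm]; exact (Metric.mem_ball.1 hy).le)
    rw [ENNReal.toReal_ofReal (by linarith), ENNReal.toReal_ofReal (by linarith)] at this
    -- Density gives `m = c ρ^n`, and `ρ^(n/P + s) (c ρ^n)^(-1/P) = c^(-1/P) ρ^s`.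
    convert this using 4
    rw [Real.mul_rpow hc.le (by positivity), ← Real.rpow_natCast, ← Real.rpow_mul hρ.le,
      mul_left_comm, ← Real.rpow_add hρ]
    congr 2
    ring
  generalize hG : eLpNorm (fun y => quotient s (ENNReal.ofReal P) u (x, y)) (ENNReal.ofReal P) μ = G
    at key ⊢
  rcases eq_or_ne G ∞ with rfl | hGt
  -- If `G = ∞`, the right side is infinite because `u` has nonzero `L^t` norm.
  · rw [ENNReal.top_rpow_of_pos (by linarith), ENNReal.mul_top, ENNReal.mul_top]
    · simp
    · exact (ENNReal.ofReal_pos.2 (by positivity)).ne'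
    · exact (ENNReal.rpow_pos (pos_iff_ne_zero.2 hN0) hN).ne'
  have k1 := fun ρ hρ hρR => key ht1 ρ hρ hρR
  have k2 := key le_rfl R hR le_rfl
  rw [ENNReal.ofReal_one] at k2
  clear key
  generalize eLpNorm u (ENNReal.ofReal t) μ = N at *
  generalize eLpNorm u 1 μ = L at *
  lift G to ℝ≥0 using hGt
  lift N to ℝ≥0 using hN
  lift L to ℝ≥0 using hL
  have hN0' : (0 : ℝ) < N := by
    have : N ≠ 0 := by simpa using hN0
    exact_mod_cast pos_iff_ne_zero.2 this
  have hreal : |u x| ≤ (c * R ^ n) ^ (-1 : ℝ) * L +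
      (c ^ (-(1 / t)) + c ^ (-(1 / P))) * ((N : ℝ) ^ (s * P / n) * (G : ℝ) ^ (1 - s * P / n)) := by
    refine le_of_forall_radius hν hP0 hs hsP hA.le hB.le (by positivity) hR hN0' L.coe_nonneg G.coe_nonneg ?_ ?_
    · intro ρ hρ hρR
      have := k1 ρ hρ hρR
      rw [Real.enorm_eq_ofReal_abs, ← ENNReal.ofReal_coe_nnreal, ← ENNReal.ofReal_coe_nnreal,
        ← ENNReal.ofReal_mul (by positivity), ← ENNReal.ofReal_mul (by positivity),
        ← ENNReal.ofReal_add (by positivity) (by positivity),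
        ENNReal.ofReal_le_ofReal_iff (by positivity)] at this
      refine this.trans (le_of_eq ?_)
      rw [Real.mul_rpow hc.le (by positivity), ← Real.rpow_natCast, ← Real.rpow_mul hρ.le,
        show (n : ℝ) * -(1 / t) = -(n / P - s) by
          rw [ht]
          have : (n : ℝ) - s * P ≠ 0 := by linarith
          field_simp]
    · have := k2
      rw [Real.enorm_eq_ofReal_abs, ← ENNReal.ofReal_coe_nnreal, ← ENNReal.ofReal_coe_nnreal,
        ← ENNReal.ofReal_mul (by positivity), ← ENNReal.ofReal_mul (by positivity),
        ← ENNReal.ofReal_add (by positivity) (by positivity),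
        ENNReal.ofReal_le_ofReal_iff (by positivity)] at this
      simpa using this
  rw [Real.enorm_eq_ofReal_abs, ← ENNReal.ofReal_coe_nnreal, ← ENNReal.ofReal_coe_nnreal,
    ← ENNReal.ofReal_coe_nnreal, ENNReal.ofReal_rpow_of_nonneg N.coe_nonneg (by positivity),
    ENNReal.ofReal_rpow_of_nonneg G.coe_nonneg (by linarith), ← ENNReal.ofReal_mul (by positivity),
    ← ENNReal.ofReal_mul (by positivity), ← ENNReal.ofReal_mul (by positivity),
    ← ENNReal.ofReal_add (by positivity) (by positivity)]
  exact ENNReal.ofReal_le_ofReal hreal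

/-- The `L^t` norm of the pointwise bound closes up because `(1 - sP/n) t = P`: by Tonelli the slice
norms integrate to the full seminorm. Finiteness of the `L^t` norm is what allows the absorption. -/
theorem eLpNorm_le_of_ne_top (hn : 0 < n) {P R c t : ℝ} (hP : 1 ≤ P) (hs : 0 < s)
    (hsP : s * P < n) (hR : 0 < R) (hc : 0 < c) (ht : t = n * P / (n - s * P)) (ht1 : 1 ≤ t)
    {μ : Measure (EuclideanSpace ℝ (Fin n))} [IsFiniteMeasure μ]
    (hμ : ∀ᵐ x ∂μ, ∀ ρ, 0 < ρ → ρ ≤ R → ENNReal.ofReal (c * ρ ^ n) ≤ μ (Metric.ball x ρ)) :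
    ∃ K : ℝ≥0, ∀ u : EuclideanSpace ℝ (Fin n) → ℝ, AEStronglyMeasurable u μ →
      eLpNorm u (ENNReal.ofReal t) μ ≠ ∞ →
      eLpNorm u (ENNReal.ofReal t) μ ≤ K * (eLpNorm u 1 μ +
        eLpNorm (quotient s (ENNReal.ofReal P) u) (ENNReal.ofReal P) (μ.prod μ)) := by
  have hν : (0 : ℝ) < n := by exact_mod_cast hn
  have hP0 : 0 < P := by linarith
  have ht0 : 0 < t := by linarith
  have hθ : s * P / n < 1 := (div_lt_one hν).2 hsP
  have hθ0 : 0 < 1 - s * P / n := by linarith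
  have hθt : (1 - s * P / n) * t = P := by
    rw [ht]
    have : (n : ℝ) - s * P ≠ 0 := by linarith
    field_simp
  set E : ℝ := c ^ (-(1 / t)) + c ^ (-(1 / P)) with hE
  have hE0 : 0 < E := by positivity
  set D : ℝ := (c * R ^ n) ^ (-1 : ℝ) with hD
  have hD0 : 0 < D := by positivity
  set D' : ℝ := D * (μ Set.univ).toReal ^ (1 / t) with hD'
  have hD'0 : 0 ≤ D' := by positivity
  have hK : 0 < 2 * D' + (2 * E) ^ (1 / (1 - s * P / n)) := by positivity
  obtain ⟨K, hKeq⟩ : ∃ K : ℝ≥0, (K : ℝ) = 2 * D' + (2 * E) ^ (1 / (1 - s * P / n)) :=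
    ⟨⟨_, hK.le⟩, rfl⟩
  rw [← hKeq] at hK
  refine ⟨K, fun u hu hN => ?_⟩
  rcases eq_or_ne (eLpNorm u (ENNReal.ofReal t) μ) 0 with hN0 | hN0
  · rw [hN0]
    exact zero_le
  have hL : eLpNorm u 1 μ ≠ ∞ := by
    refine ((eLpNorm_le_eLpNorm_mul_rpow_measure_univ (ofReal_one_le ht1) hu).trans_lt ?_).ne
    refine ENNReal.mul_lt_top hN.lt_top (ENNReal.rpow_lt_top_of_nonneg ?_ (measure_ne_top _ _))
    rw [ENNReal.toReal_one, ENNReal.toReal_ofReal ht0.le, sub_nonneg, div_le_div_iff₀ ht0 one_pos]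
    linarith
  set G := fun x => eLpNorm (fun y => quotient s (ENNReal.ofReal P) u (x, y)) (ENNReal.ofReal P) μ
    with hG
  set Γ := eLpNorm (quotient s (ENNReal.ofReal P) u) (ENNReal.ofReal P) (μ.prod μ) with hΓ
  rcases eq_or_ne Γ ∞ with hΓt | hΓt
  · rw [hΓt, add_top, ENNReal.mul_top]
    · exact le_top
    · exact_mod_cast hK.ne'
  have hpt : ∀ᵐ x ∂μ, ‖u x‖ₑ ≤ ENNReal.ofReal D * eLpNorm u 1 μ +
      ENNReal.ofReal E * (eLpNorm u (ENNReal.ofReal t) μ ^ (s * P / n) * G x ^ (1 - s * P / n)) := by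
    filter_upwards [hμ] with x hx
    exact enorm_le_interpolation hn hP hs hsP hR hc ht ht1 hx hu hN0 hN hL
  have hGm : AEMeasurable G μ := aemeasurable_eLpNorm_quotient hP0 hu
  have hGint : ∫⁻ x, (G x ^ (1 - s * P / n)) ^ t ∂μ = Γ ^ P := by
    simp_rw [← ENNReal.rpow_mul, hθt]
    exact lintegral_eLpNorm_quotient_rpow hP0 hu
  have hmain : eLpNorm u (ENNReal.ofReal t) μ ≤ ENNReal.ofReal D' * eLpNorm u 1 μ +
      ENNReal.ofReal E *
        (eLpNorm u (ENNReal.ofReal t) μ ^ (s * P / n) * Γ ^ (1 - s * P / n)) := by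
    have ht0' : ENNReal.ofReal t ≠ 0 := (ENNReal.ofReal_pos.2 ht0).ne'
    generalize hNd : eLpNorm u (ENNReal.ofReal t) μ = N at *
    rw [eLpNorm_eq_lintegral_rpow_enorm_toReal ht0' ENNReal.ofReal_ne_top,
      ENNReal.toReal_ofReal ht0.le] at hNd
    rw [← hNd]
    refine (ENNReal.rpow_le_rpow (lintegral_mono_ae (hpt.mono fun x hx =>
      ENNReal.rpow_le_rpow hx ht0.le)) (by positivity)).trans ?_
    refine (ENNReal.lintegral_Lp_add_le aemeasurable_const
      (((hGm.pow_const _).const_mul _).const_mul _) ht1).trans ?_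
    rw [hNd]
    refine add_le_add (le_of_eq ?_) (le_of_eq ?_)
    · rw [lintegral_const, ENNReal.mul_rpow_of_nonneg _ _ (by positivity), one_div,
        ENNReal.rpow_rpow_inv ht0.ne', hD', ENNReal.ofReal_mul hD0.le,
        ← ENNReal.ofReal_rpow_of_nonneg ENNReal.toReal_nonneg (by positivity),
        ENNReal.ofReal_toReal (measure_ne_top _ _), one_div]
      ring
    · simp_rw [ENNReal.mul_rpow_of_nonneg _ _ ht0.le]
      rw [lintegral_const_mul' _ _ (by finiteness), lintegral_const_mul' _ _ (by
          exact ENNReal.rpow_ne_top_of_nonneg ht0.le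
            (ENNReal.rpow_ne_top_of_nonneg (by positivity) hN)),
        hGint, ENNReal.mul_rpow_of_nonneg _ _ (by positivity),
        ENNReal.mul_rpow_of_nonneg _ _ (by positivity), one_div,
        ENNReal.rpow_rpow_inv ht0.ne', ENNReal.rpow_rpow_inv ht0.ne', ← ENNReal.rpow_mul,
        eq_div_of_mul_eq ht0.ne' hθt, div_eq_mul_inv P t]
  clear_value Γ
  clear hpt hGint
  generalize eLpNorm u (ENNReal.ofReal t) μ = N at *
  generalize eLpNorm u 1 μ = L at *
  lift Γ to ℝ≥0 using hΓt
  lift N to ℝ≥0 using hN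
  lift L to ℝ≥0 using hL
  have hN0' : (0 : ℝ) < N := by
    have : N ≠ 0 := by simpa using hN0
    exact_mod_cast pos_iff_ne_zero.2 this
  rw [← ENNReal.ofReal_coe_nnreal, ← ENNReal.ofReal_coe_nnreal, ← ENNReal.ofReal_coe_nnreal,
    ENNReal.ofReal_rpow_of_nonneg N.coe_nonneg (by positivity),
    ENNReal.ofReal_rpow_of_nonneg Γ.coe_nonneg (by linarith), ← ENNReal.ofReal_mul (by positivity),
    ← ENNReal.ofReal_mul (by positivity), ← ENNReal.ofReal_mul (by positivity),
    ← ENNReal.ofReal_add (by positivity) (by positivity),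
    ENNReal.ofReal_le_ofReal_iff (by positivity)] at hmain
  have := le_of_le_add_interpolation hθ hD'0 hE0.le hN0' L.coe_nonneg Γ.coe_nonneg hmain
  rw [← hKeq] at this
  exact_mod_cast this

/-- Truncation of a function to values in `[-k, k]`. -/
noncomputable def truncate {α : Type*} (k : ℕ) (u : α → ℝ) : α → ℝ :=
  fun x => max (-(k : ℝ)) (min (u x) k)

theorem abs_truncate_sub_le {α : Type*} (k : ℕ) (u : α → ℝ) (x y : α) :
    |truncate k u x - truncate k u y| ≤ |u x - u y| :=
  by
  have h := abs_min_sub_min_le_max (u x) k (u y) k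
  rw [sub_self, abs_zero, max_eq_left (abs_nonneg _)] at h
  have h' := abs_max_sub_max_le_max (-(k : ℝ)) (min (u x) k) (-(k : ℝ)) (min (u y) k)
  rw [sub_self, abs_zero, max_eq_right (abs_nonneg (min (u x) (k : ℝ) - min (u y) k))] at h'
  exact h'.trans h

theorem abs_truncate_le {α : Type*} (k : ℕ) (u : α → ℝ) (x : α) : |truncate k u x| ≤ |u x| := by
  have hk : (0 : ℝ) ≤ k := k.cast_nonneg
  rw [truncate, abs_le]
  rcases abs_cases (u x) with h | h <;>
  constructor <;> simp only [le_max_iff, max_le_iff, le_min_iff, min_le_iff] <;> grind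

theorem abs_truncate_le_nat {α : Type*} (k : ℕ) (u : α → ℝ) (x : α) : |truncate k u x| ≤ k := by
  have hk : (0 : ℝ) ≤ k := k.cast_nonneg
  rw [truncate, abs_le]
  exact ⟨le_max_left _ _, max_le (by linarith) (min_le_right _ _)⟩

theorem tendsto_truncate {α : Type*} (u : α → ℝ) (x : α) :
    Tendsto (fun k => truncate k u x) atTop (𝓝 (u x)) := by
  obtain ⟨m, hm⟩ := exists_nat_ge |u x|
  refine tendsto_const_nhds.congr' ?_
  filter_upwards [eventually_ge_atTop m] with k hk
  have h : |u x| ≤ k := hm.trans (by exact_mod_cast hk)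
  rw [truncate, min_eq_left (abs_le.1 h).2, max_eq_right (abs_le.1 h).1]

/-- The fractional Sobolev inequality at the critical exponent, for a finite measure whose balls
are at least as large as those of Lebesgue measure up to a constant. -/
theorem exists_eLpNorm_le (hn : 0 < n) {P R c t : ℝ} (hP : 1 ≤ P) (hs : 0 < s)
    (hsP : s * P < n) (hR : 0 < R) (hc : 0 < c) (ht : t = n * P / (n - s * P)) (ht1 : 1 ≤ t)
    {μ : Measure (EuclideanSpace ℝ (Fin n))} [IsFiniteMeasure μ]
    (hμ : ∀ᵐ x ∂μ, ∀ ρ, 0 < ρ → ρ ≤ R → ENNReal.ofReal (c * ρ ^ n) ≤ μ (Metric.ball x ρ)) :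
    ∃ K : ℝ≥0, ∀ u : EuclideanSpace ℝ (Fin n) → ℝ, AEStronglyMeasurable u μ →
      eLpNorm u (ENNReal.ofReal t) μ ≤ K * (eLpNorm u 1 μ +
        eLpNorm (quotient s (ENNReal.ofReal P) u) (ENNReal.ofReal P) (μ.prod μ)) := by
  obtain ⟨K, hK⟩ := eLpNorm_le_of_ne_top hn hP hs hsP hR hc ht ht1 hμ
  refine ⟨K, fun u hu => ?_⟩
  have hm : ∀ k, AEStronglyMeasurable (truncate k u) μ := fun k =>
    (aemeasurable_const.max (hu.aemeasurable.min aemeasurable_const)).aestronglyMeasurable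
  -- Truncations are bounded, hence in `L^t`, and increase neither the `L^1` norm nor the seminorm;
  -- Fatou removes the truncation.
  refine (Lp.eLpNorm_lim_le_liminf_eLpNorm hm u
    (Eventually.of_forall (tendsto_truncate u))).trans ?_
  refine liminf_le_of_frequently_le' (Eventually.frequently (Eventually.of_forall fun k => ?_))
  have hb : MemLp (truncate k u) (ENNReal.ofReal t) μ :=
    MemLp.of_bound (hm k) k (Eventually.of_forall (abs_truncate_le_nat k u))
  refine (hK _ (hm k) hb.2.ne).trans ?_
  gcongr K * (?_ + ?_)
  · exact eLpNorm_mono fun x => abs_truncate_le k u x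
  · refine eLpNorm_mono fun z => ?_
    simp only [quotient, Real.norm_eq_abs, abs_div]
    exact div_le_div_of_nonneg_right (abs_truncate_sub_le k u _ _) (abs_nonneg _)

end FracSobolev

/-! ### Averaging operators and compactness in `L^1`. -/

namespace FracSobolev

open Filter Topology

variable {n : ℕ}

/-- Integration over a set as a continuous linear functional on `L¹`. -/
noncomputable def setIntegralCLM {α : Type*} [MeasurableSpace α] (μ : Measure α) (B : Set α) :
    Lp ℝ 1 μ →L[ℝ] ℝ where
  toFun f := ∫ x in B, f x ∂μ
  map_add' f g := by
    rw [← integral_add (L1.integrable_coeFn f).integrableOn (L1.integrable_coeFn g).integrableOn]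
    exact integral_congr_ae (ae_restrict_of_ae (Lp.coeFn_add f g))
  map_smul' c f := by
    rw [RingHom.id_apply, ← integral_smul]
    exact integral_congr_ae (ae_restrict_of_ae (Lp.coeFn_smul c f))
  cont := continuous_setIntegral B

/-- The finite rank operator that replaces `f` on each set `A i` by its mean over `B i`. -/
noncomputable def averageCLM {α ι : Type*} [Fintype ι] [MeasurableSpace α] (μ : Measure α)
    [IsFiniteMeasure μ] {A : ι → Set α} (hA : ∀ i, MeasurableSet (A i)) (B : ι → Set α) :
    Lp ℝ 1 μ →L[ℝ] Lp ℝ 1 μ :=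
  (∑ i, (ContinuousLinearMap.proj (R := ℝ) (φ := fun _ : ι => ℝ) i).smulRight
    (indicatorConstLp 1 (hA i) (measure_ne_top μ _) (1 : ℝ))).comp
    (ContinuousLinearMap.pi fun i => (μ.real (B i))⁻¹ • setIntegralCLM μ (B i))

theorem isCompactOperator_averageCLM {α ι : Type*} [Fintype ι] [MeasurableSpace α] (μ : Measure α)
    [IsFiniteMeasure μ] {A : ι → Set α} (hA : ∀ i, MeasurableSet (A i)) (B : ι → Set α) :
    IsCompactOperator (averageCLM μ hA B) :=
  (isCompactOperator_of_locallyCompactSpace_dom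
    (ContinuousLinearMap.pi fun i => (μ.real (B i))⁻¹ • setIntegralCLM μ (B i))).clm_comp _

theorem coeFn_sum_ae {α ι : Type*} [MeasurableSpace α] {μ : Measure α} (t : Finset ι)
    (f : ι → Lp ℝ 1 μ) : ∀ᵐ x ∂μ, (∑ i ∈ t, f i : Lp ℝ 1 μ) x = ∑ i ∈ t, f i x := by
  classical
  induction t using Finset.induction_on with
  | empty =>
    filter_upwards [Lp.coeFn_zero ℝ 1 μ] with x hx
    simpa using hx
  | insert i t hi ih =>
    rw [Finset.sum_insert hi]
    filter_upwards [ih, Lp.coeFn_add (f i) (∑ j ∈ t, f j)] with x hx hadd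
    rw [hadd, Pi.add_apply, hx, Finset.sum_insert hi]

theorem averageCLM_coeFn {α ι : Type*} [Fintype ι] [MeasurableSpace α] (μ : Measure α)
    [IsFiniteMeasure μ] {A : ι → Set α} (hA : ∀ i, MeasurableSet (A i))
    (hdisj : Pairwise (Function.onFun Disjoint A)) (B : ι → Set α) (f : Lp ℝ 1 μ) :
    ∀ᵐ x ∂μ, ∀ i, x ∈ A i → averageCLM μ hA B f x = (μ.real (B i))⁻¹ * ∫ y in B i, f y ∂μ := by
  have h : averageCLM μ hA B f = ∑ i, ((μ.real (B i))⁻¹ * ∫ y in B i, f y ∂μ) •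
      indicatorConstLp 1 (hA i) (measure_ne_top μ _) (1 : ℝ) := by
    simp [averageCLM, setIntegralCLM]
  rw [h]
  have h1 : ∀ᵐ x ∂μ, ∀ i, (((μ.real (B i))⁻¹ * ∫ y in B i, f y ∂μ) •
      indicatorConstLp 1 (hA i) (measure_ne_top μ _) (1 : ℝ) : Lp ℝ 1 μ) x =
      ((μ.real (B i))⁻¹ * ∫ y in B i, f y ∂μ) * (A i).indicator (fun _ => 1) x := by
    refine ae_all_iff.2 fun i => ?_
    filter_upwards [Lp.coeFn_smul ((μ.real (B i))⁻¹ * ∫ y in B i, f y ∂μ)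
      (indicatorConstLp 1 (hA i) (measure_ne_top μ _) (1 : ℝ) : Lp ℝ 1 μ),
      indicatorConstLp_coeFn (p := 1) (hs := hA i) (hμs := measure_ne_top μ _) (c := (1 : ℝ))]
      with x hx hx'
    rw [hx, Pi.smul_apply, smul_eq_mul, hx']
  filter_upwards [h1, coeFn_sum_ae Finset.univ (fun i =>
    (((μ.real (B i))⁻¹ * ∫ y in B i, f y ∂μ) •
      indicatorConstLp 1 (hA i) (measure_ne_top μ _) (1 : ℝ) : Lp ℝ 1 μ))] with x hx hsum i hi
  rw [hsum, Finset.sum_eq_single i, hx, Set.indicator_of_mem hi, mul_one]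
  · intro j _ hj
    rw [hx, Set.indicator_of_notMem, mul_zero]
    exact fun hjx => (hdisj hj).le_bot ⟨hjx, hi⟩
  · simp

/-- On sets of small diameter and comparable measure, `f` is close to its mean. -/
theorem enorm_sub_average_le {s : ℝ} {p : ℝ≥0∞} (hs : 0 ≤ s) (hp : 1 ≤ p)
    {μ : Measure (EuclideanSpace ℝ (Fin n))} [IsFiniteMeasure μ]
    {f : EuclideanSpace ℝ (Fin n) → ℝ} (hf : Integrable f μ)
    {B : Set (EuclideanSpace ℝ (Fin n))} (hB : MeasurableSet B) {d m : ℝ} (hd0 : 0 ≤ d)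
    (hm : 0 < m) (hmB : ENNReal.ofReal m ≤ μ B)
    {x : EuclideanSpace ℝ (Fin n)} (hd : ∀ y ∈ B, ‖x - y‖ ≤ d) :
    ‖f x - (μ.real B)⁻¹ * ∫ y in B, f y ∂μ‖ₑ ≤
      ENNReal.ofReal (d ^ ((n : ℝ) / p.toReal + s) * m ^ (-(1 / p.toReal))) *
        eLpNorm (fun y => quotient s p f (x, y)) p μ := by
  have hB0 : μ B ≠ 0 := ((ENNReal.ofReal_pos.2 hm).trans_le hmB).ne'
  have hBt : μ B ≠ ∞ := measure_ne_top _ _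
  have hBr : μ.real B ≠ 0 := (ENNReal.toReal_pos hB0 hBt).ne'
  have h1 : f x - (μ.real B)⁻¹ * ∫ y in B, f y ∂μ =
      (μ.real B)⁻¹ * ∫ y in B, (f x - f y) ∂μ := by
    rw [integral_sub (integrable_const _) hf.integrableOn, setIntegral_const, smul_eq_mul, mul_sub,
      inv_mul_cancel_left₀ hBr]
  have h2 : ‖(μ.real B)⁻¹‖ₑ = (μ B)⁻¹ := by
    rw [enorm_inv hBr, Measure.real, Real.enorm_eq_ofReal ENNReal.toReal_nonneg,
      ENNReal.ofReal_toReal hBt]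
  have h5 := ofReal_rpow_neg_mul (e := 1 / p.toReal) hm hmB hBt (by positivity)
  calc ‖f x - (μ.real B)⁻¹ * ∫ y in B, f y ∂μ‖ₑ
      ≤ (μ B)⁻¹ * ∫⁻ y in B, ‖f x - f y‖ₑ ∂μ := by
        rw [h1, enorm_mul, h2]
        gcongr
        exact enorm_integral_le_lintegral_enorm _
    _ ≤ (μ B)⁻¹ * (ENNReal.ofReal (d ^ ((n : ℝ) / p.toReal + s)) *
      (eLpNorm (fun y => quotient s p f (x, y)) p μ * μ B ^ (1 - 1 / p.toReal))) := by
        gcongr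
        exact setLIntegral_enorm_sub_le hs hp hf.1 hB hd
    _ = ENNReal.ofReal (d ^ ((n : ℝ) / p.toReal + s)) * (μ B ^ (1 - 1 / p.toReal) / μ B) *
          eLpNorm (fun y => quotient s p f (x, y)) p μ := by
        simp only [div_eq_mul_inv]
        ring
    _ ≤ _ := by
        rw [ENNReal.ofReal_mul (Real.rpow_nonneg hd0 _)]
        gcongr

theorem lintegral_eLpNorm_quotient_le {s P : ℝ} (hP : 1 ≤ P)
    {μ : Measure (EuclideanSpace ℝ (Fin n))} [IsFiniteMeasure μ]
    {u : EuclideanSpace ℝ (Fin n) → ℝ} (hu : AEStronglyMeasurable u μ) :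
    ∫⁻ x, eLpNorm (fun y => quotient s (ENNReal.ofReal P) u (x, y)) (ENNReal.ofReal P) μ ∂μ ≤
      eLpNorm (quotient s (ENNReal.ofReal P) u) (ENNReal.ofReal P) (μ.prod μ) *
        μ Set.univ ^ (1 - 1 / P) := by
  have hP0 : 0 < P := by linarith
  have h := eLpNorm'_le_eLpNorm'_mul_rpow_measure_univ one_pos hP
    (aemeasurable_eLpNorm_quotient (s := s) hP0 hu).aestronglyMeasurable
  simp only [eLpNorm', enorm_eq_self, ENNReal.rpow_one, div_one,
    lintegral_eLpNorm_quotient_rpow hP0 hu, one_div, ENNReal.rpow_rpow_inv hP0.ne'] at h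
  simpa using h

/-- Averaging operators approximate the identity of `L¹` on functions with bounded difference
quotients. -/
theorem exists_isCompactOperator_enorm_sub_le {Ω : Set (EuclideanSpace ℝ (Fin n))}
    (hΩ : IsBoundedLipschitzDomain Ω) {s P : ℝ} (hs : 0 < s) (hP : 1 ≤ P) {ε : ℝ} (hε : 0 < ε) :
    ∃ T : Lp ℝ 1 (volume.restrict Ω) →L[ℝ] Lp ℝ 1 (volume.restrict Ω), IsCompactOperator T ∧
      ∀ f : Lp ℝ 1 (volume.restrict Ω), ‖f - T f‖ₑ ≤ ENNReal.ofReal ε *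
        gagliardo Ω s (ENNReal.ofReal P) f := by
  have := hΩ.isFiniteMeasure
  obtain ⟨R, hR, c, hc, hdens⟩ := hΩ.exists_volume_ball_ge
  set μ := volume.restrict Ω with hμ
  have hP0 : 0 < P := by linarith
  -- The averaging error is `κ h^s`: the power of 2 comes from the diameter `2h` of the balls, `c`
  -- from density, the last factor from Hölder in `x`.
  set κ : ℝ := 2 ^ ((n : ℝ) / P + s) * c ^ (-(1 / P)) * (μ Set.univ).toReal ^ (1 - 1 / P) with hκ
  have hκ0 : 0 ≤ κ := by positivity
  obtain ⟨h, hh0, hhR, hhε⟩ : ∃ h > 0, h ≤ R ∧ κ * h ^ s ≤ ε := by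
    have hlim : Tendsto (fun h : ℝ => κ * h ^ s) (𝓝[>] 0) (𝓝 0) := by
      have : Tendsto (fun h : ℝ => κ * h ^ s) (𝓝 0) (𝓝 (κ * 0 ^ s)) :=
        ((Real.continuousAt_rpow_const 0 s (Or.inr hs.le)).tendsto).const_mul κ
      rw [Real.zero_rpow hs.ne', mul_zero] at this
      exact this.mono_left nhdsWithin_le_nhds
    obtain ⟨h, h1, h2, h3⟩ := ((hlim.eventually (eventually_le_nhds hε)).and
      ((eventually_mem_nhdsWithin (a := (0 : ℝ)) (s := Set.Ioi 0)).and
        (mem_nhdsWithin_of_mem_nhds (Iic_mem_nhds hR)))).exists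
    exact ⟨h, h2, h3, h1⟩
  obtain ⟨t, htΩ, htfin, hcover⟩ := Metric.finite_approx_of_totallyBounded
    (hΩ.isBounded.isCompact_closure.totallyBounded.subset subset_closure) h hh0
  obtain ⟨N, y, hy⟩ := htfin.fin_param
  have hcov : ∀ x ∈ Ω, ∃ i, x ∈ Metric.ball (y i) h := fun x hx => by
    obtain ⟨z, hz, hxz⟩ := Set.mem_iUnion₂.1 (hcover hx)
    rw [← hy.2] at hz
    obtain ⟨i, rfl⟩ := hz
    exact ⟨i, hxz⟩
  have hyΩ : ∀ i, y i ∈ Ω := fun i => htΩ (hy.2 ▸ Set.mem_range_self i)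
  -- Values are assigned on the disjointed pieces, but means are taken over whole balls centred in
  -- `Ω`: density bounds the measure of the balls, not of the pieces.
  set B : Fin N → Set (EuclideanSpace ℝ (Fin n)) := fun i => Metric.ball (y i) h with hBdef
  have hB : ∀ i, MeasurableSet (B i) := fun i => Metric.isOpen_ball.measurableSet
  have hA : ∀ i, MeasurableSet (disjointed B i) := fun i =>
    disjointedRec (fun _ _ ht => ht.diff (hB _)) (hB i)
  refine ⟨averageCLM μ hA B, isCompactOperator_averageCLM μ hA B, fun f => ?_⟩
  have hpt : ∀ᵐ x ∂μ, ‖(f - averageCLM μ hA B f) x‖ₑ ≤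
      ENNReal.ofReal ((2 * h) ^ ((n : ℝ) / P + s) * (c * h ^ n) ^ (-(1 / P))) *
        eLpNorm (fun y => quotient s (ENNReal.ofReal P) f (x, y)) (ENNReal.ofReal P) μ := by
    filter_upwards [Lp.coeFn_sub f (averageCLM μ hA B f),
      averageCLM_coeFn μ hA (disjoint_disjointed B) B f,
      ae_restrict_mem hΩ.isOpen.measurableSet] with x hsub hT hx
    obtain ⟨i, hi⟩ : ∃ i, x ∈ disjointed B i := by
      rw [← Set.mem_iUnion, iUnion_disjointed, Set.mem_iUnion]
      exact hcov x hx
    rw [hsub, Pi.sub_apply, hT i hi]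
    have hxi : dist x (y i) < h := disjointed_subset B i hi
    have := enorm_sub_average_le (x := x) (d := 2 * h) hs.le (ofReal_one_le hP)
      (L1.integrable_coeFn f) (hB i) (by positivity) (by positivity)
      (hdens (y i) (hyΩ i) h hh0 hhR) (fun z hz => by
        have hz' : dist z (y i) < h := hz
        rw [← dist_eq_norm]
        linarith [dist_triangle_right x z (y i)])
    rwa [ENNReal.toReal_ofReal hP0.le] at this
  have hreal : (2 * h) ^ ((n : ℝ) / P + s) * (c * h ^ n) ^ (-(1 / P)) =
      2 ^ ((n : ℝ) / P + s) * c ^ (-(1 / P)) * h ^ s := by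
    rw [Real.mul_rpow hc.le (by positivity), ← Real.rpow_natCast, ← Real.rpow_mul hh0.le,
      Real.mul_rpow two_pos.le hh0.le, Real.rpow_add hh0,
      show (n : ℝ) * -(1 / P) = -(n / P) by ring, Real.rpow_neg hh0.le]
    have : h ^ ((n : ℝ) / P) ≠ 0 := (Real.rpow_pos_of_pos hh0 _).ne'
    field_simp
  rw [hreal] at hpt
  have hexp : 0 ≤ 1 - 1 / P := by
    rw [sub_nonneg, div_le_one hP0]
    exact hP
  calc ‖f - averageCLM μ hA B f‖ₑ
      = ∫⁻ x, ‖(f - averageCLM μ hA B f) x‖ₑ ∂μ := by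
        rw [Lp.enorm_def, eLpNorm_one_eq_lintegral_enorm]
    _ ≤ ENNReal.ofReal (2 ^ ((n : ℝ) / P + s) * c ^ (-(1 / P)) * h ^ s) *
        ∫⁻ x, eLpNorm (fun y => quotient s (ENNReal.ofReal P) f (x, y)) (ENNReal.ofReal P) μ ∂μ := by
        rw [← lintegral_const_mul' _ _ ENNReal.ofReal_ne_top]
        exact lintegral_mono_ae hpt
    _ ≤ ENNReal.ofReal (2 ^ ((n : ℝ) / P + s) * c ^ (-(1 / P)) * h ^ s) *
        (gagliardo Ω s (ENNReal.ofReal P) f * ENNReal.ofReal ((μ Set.univ).toReal ^ (1 - 1 / P))) := by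
        gcongr
        refine (lintegral_eLpNorm_quotient_le hP (Lp.aestronglyMeasurable f)).trans (le_of_eq ?_)
        rw [← ENNReal.ofReal_rpow_of_nonneg ENNReal.toReal_nonneg hexp,
          ENNReal.ofReal_toReal (measure_ne_top _ _)]
        rfl
    _ = ENNReal.ofReal (κ * h ^ s) * gagliardo Ω s (ENNReal.ofReal P) f := by
        rw [mul_left_comm, mul_comm, ← ENNReal.ofReal_mul (by positivity), hκ]
        ring_nf
    _ ≤ _ := by gcongr

/-- An embedding into `L¹` is compact if the norm controls some Gagliardo seminorm. -/
theorem isCompactOperator_of_gagliardo_le {Ω : Set (EuclideanSpace ℝ (Fin n))}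
    (hΩ : IsBoundedLipschitzDomain Ω) {s s' P : ℝ} {q p : ℝ≥0∞} [Fact (1 ≤ q)] [Fact (1 ≤ p)]
    (hs' : 0 < s') (hP : 1 ≤ P) {K : ℝ≥0}
    (hK : ∀ u : C1 Ω s q p, gagliardo Ω s' (ENNReal.ofReal P) u.fn ≤ K * gagliardo Ω s p u.fn)
    {ι : M Ω s q p →L[ℝ] Lp ℝ 1 (volume.restrict Ω)} (hι : IsEmbedding ι) :
    IsCompactOperator ι := by
  choose T hTc hT using fun k : ℕ => exists_isCompactOperator_enorm_sub_le hΩ hs' hP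
    (Nat.one_div_pos_of_nat (α := ℝ) (n := k))
  have hbound : ∀ k, ‖ι - (T k).comp ι‖ ≤ 1 / ((k : ℝ) + 1) * K := by
    intro k
    refine ContinuousLinearMap.opNorm_le_bound _ (by positivity) fun x => ?_
    induction x using UniformSpace.Completion.induction_on with
    | hp => exact isClosed_le (by fun_prop) (by fun_prop)
    | ih u =>
      have hg : gagliardo Ω s p u.fn ≠ ∞ := u.memLp_quotient.2.ne
      have hgu : gagliardo Ω s' (ENNReal.ofReal P) (ι (u : M Ω s q p)) =
          gagliardo Ω s' (ENNReal.ofReal P) u.fn := by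
        have h1 := hι.2 u
        refine eLpNorm_congr_ae ?_
        filter_upwards [Measure.quasiMeasurePreserving_fst.ae h1,
          Measure.quasiMeasurePreserving_snd.ae h1] with z hz1 hz2
        simp only [quotient, hz1, hz2]
      have h2 := (hT k (ι u)).trans (mul_le_mul_right (hgu.le.trans (hK u)) _)
      have h3 := ENNReal.toReal_mono (by finiteness) h2
      rw [toReal_enorm, ENNReal.toReal_mul, ENNReal.toReal_mul,
        ENNReal.toReal_ofReal (by positivity), ← mul_assoc] at h3
      rw [UniformSpace.Completion.norm_coe, C1.norm_def]
      refine h3.trans ?_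
      rw [mul_add]
      exact le_add_of_nonneg_left (by positivity)
  have hlim : Tendsto (fun k => (T k).comp ι) atTop (𝓝 ι) := by
    rw [tendsto_iff_norm_sub_tendsto_zero]
    refine squeeze_zero (fun _ => norm_nonneg _) (fun k => (norm_sub_rev _ _).le.trans (hbound k)) ?_
    simpa using (tendsto_one_div_add_atTop_nhds_zero_nat (𝕜 := ℝ)).mul_const (K : ℝ)
  exact isCompactOperator_of_tendsto hlim (Eventually.of_forall fun k => (hTc k).comp_clm ι)

end FracSobolev

/-! ### Interpolation and comparison of exponents. -/

namespace FracSobolev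

open Filter Topology

variable {n : ℕ} {Ω : Set (EuclideanSpace ℝ (Fin n))} {s : ℝ} {q p : ℝ≥0∞}

/-- Interpolation of `L^r` between `L¹` and `L^R`. -/
theorem exists_eLpNorm_le_interpolation {α : Type*} [MeasurableSpace α] {μ : Measure α}
    {r R : ℝ≥0∞} (hr : 1 < r) (hrR : r < R) :
    ∃ θ : ℝ, 0 < θ ∧ θ < 1 ∧ ∀ f : α → ℝ, AEStronglyMeasurable f μ →
      eLpNorm f r μ ≤ eLpNorm f 1 μ ^ θ * eLpNorm f R μ ^ (1 - θ) := by
  have hr0 : r⁻¹ < 1 := ENNReal.inv_lt_one.2 hr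
  have hRr : R⁻¹ < r⁻¹ := ENNReal.inv_lt_inv.2 hrR
  have har : r⁻¹ = ENNReal.ofReal r⁻¹.toReal := (ENNReal.ofReal_toReal (hr0.trans_le le_top).ne).symm
  have hbR : R⁻¹ = ENNReal.ofReal R⁻¹.toReal :=
    (ENNReal.ofReal_toReal (hRr.trans_le le_top).ne).symm
  set a := r⁻¹.toReal
  set b := R⁻¹.toReal
  have hb0 : 0 ≤ b := ENNReal.toReal_nonneg
  have ha1 : a < 1 := by
    rw [har, ENNReal.ofReal_lt_one] at hr0
    exact hr0
  have hba : b < a := by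
    rw [har, hbR] at hRr
    exact (ENNReal.ofReal_lt_ofReal_iff_of_nonneg hb0).1 hRr
  have hb1 : 0 < 1 - b := by linarith
  -- The solution of `1/r = θ + (1 - θ)/R`. Reciprocals include `R = ∞` as `b = 0`.
  set θ := (a - b) / (1 - b) with hθ
  have hθ0 : 0 < θ := div_pos (by linarith) hb1
  have hθ1 : θ < 1 := (div_lt_one hb1).2 (by linarith)
  have hθ1' : 0 < 1 - θ := by linarith
  refine ⟨θ, hθ0, hθ1, fun f hf => ?_⟩
  have hc0 : ENNReal.ofReal θ ≠ 0 := (ENNReal.ofReal_pos.2 hθ0).ne'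
  have hc1 : ENNReal.ofReal (1 - θ) ≠ 0 := (ENNReal.ofReal_pos.2 hθ1').ne'
  -- Hölder is applied to `|f|^θ · |f|^(1-θ)` with exponents `1/θ` and `R/(1-θ)`.
  have : ENNReal.HolderTriple (ENNReal.ofReal θ)⁻¹ (R * (ENNReal.ofReal (1 - θ))⁻¹) r := by
    constructor
    rw [inv_inv, ENNReal.mul_inv (Or.inr (ENNReal.inv_ne_top.2 hc1))
      (Or.inr (ENNReal.inv_ne_zero.2 ENNReal.ofReal_ne_top)), inv_inv, hbR, har,
      ← ENNReal.ofReal_mul hb0, ← ENNReal.ofReal_add hθ0.le (by positivity)]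
    congr 1
    rw [hθ]
    field_simp
    ring
  have h1 := eLpNorm_norm_rpow (μ := μ) (p := (ENNReal.ofReal θ)⁻¹) f hθ0
  have h2 := eLpNorm_norm_rpow (μ := μ) (p := R * (ENNReal.ofReal (1 - θ))⁻¹) f hθ1'
  rw [ENNReal.inv_mul_cancel hc0 ENNReal.ofReal_ne_top] at h1
  rw [mul_assoc, ENNReal.inv_mul_cancel hc1 ENNReal.ofReal_ne_top, mul_one] at h2
  rw [← h1, ← h2]
  refine le_trans (le_of_eq ?_) (eLpNorm_smul_le_mul_eLpNorm (r := r)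
    (p := (ENNReal.ofReal θ)⁻¹) (q := R * (ENNReal.ofReal (1 - θ))⁻¹)
    (hf.norm.aemeasurable.pow_const (1 - θ)).aestronglyMeasurable
    (hf.norm.aemeasurable.pow_const θ).aestronglyMeasurable)
  refine eLpNorm_congr_norm_ae (Eventually.of_forall fun x => ?_)
  simp only [Pi.smul_apply', smul_eq_mul, norm_mul]
  rw [Real.norm_of_nonneg (by positivity : 0 ≤ ‖f x‖ ^ θ),
    Real.norm_of_nonneg (by positivity : 0 ≤ ‖f x‖ ^ (1 - θ)),
    ← Real.rpow_add_of_nonneg (norm_nonneg _) hθ0.le hθ1'.le, add_sub_cancel, Real.rpow_one]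

/-- Compactness transfers along an interpolation inequality. -/
theorem isCompactOperator_of_norm_le_interpolation {E F G H : Type*}
    [SeminormedAddCommGroup E] [NormedSpace ℝ E] [NormedAddCommGroup F] [NormedSpace ℝ F]
    [NormedAddCommGroup G] [NormedSpace ℝ G] [NormedAddCommGroup H] [NormedSpace ℝ H]
    [CompleteSpace G] {f : E →L[ℝ] F} {g : E →L[ℝ] G} {k : E →L[ℝ] H} {θ : ℝ} (hθ0 : 0 < θ)
    (hθ1 : θ < 1) (h : ∀ x, ‖g x‖ ≤ ‖f x‖ ^ θ * ‖k x‖ ^ (1 - θ)) (hf : IsCompactOperator f) :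
    IsCompactOperator g := by
  have hθ1' : 0 < 1 - θ := by linarith
  refine (isCompactOperator_iff_isCompact_closure_image_closedBall (g : E →ₗ[ℝ] G) one_pos).2 ?_
  have hft : TotallyBounded (f '' Metric.closedBall 0 1) :=
    ((hf.isCompact_closure_image_closedBall (f := (f : E →ₗ[ℝ] F)) 1).totallyBounded).subset
      subset_closure
  refine (TotallyBounded.closure ?_).isCompact_of_isClosed isClosed_closure
  rw [Metric.totallyBounded_iff]
  intro ε hε
  set C := (2 * ‖k‖) ^ (1 - θ) with hC
  have hC0 : 0 ≤ C := by positivity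
  set η := (ε / (C + 1)) ^ (1 / θ) with hη
  have hη0 : 0 < η := by positivity
  have hηθ : η ^ θ = ε / (C + 1) := by
    rw [hη, ← Real.rpow_mul (by positivity), one_div_mul_cancel hθ0.ne', Real.rpow_one]
  -- The net consists of images of unit ball points, so differences of preimages have norm at most 2
  -- and `C` bounds the `k` factor; `η` makes `η^θ C < ε`.
  obtain ⟨t, ht, htfin, hcov⟩ := Set.exists_subset_image_finite_and.1
    (Metric.finite_approx_of_totallyBounded hft η hη0)
  refine ⟨g '' t, htfin.image _, ?_⟩
  rintro _ ⟨x, hx, rfl⟩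
  obtain ⟨_, ⟨y, hy, rfl⟩, hxy⟩ := Set.mem_iUnion₂.1 (hcov ⟨x, hx, rfl⟩)
  refine Set.mem_iUnion₂.2 ⟨g y, ⟨y, hy, rfl⟩, ?_⟩
  have hxy' : ‖f (x - y)‖ < η := by
    rw [map_sub, ← dist_eq_norm]
    exact hxy
  have hk : ‖k (x - y)‖ ≤ 2 * ‖k‖ := by
    have h1 : ‖x‖ ≤ 1 := mem_closedBall_zero_iff.1 hx
    have h2 : ‖y‖ ≤ 1 := mem_closedBall_zero_iff.1 (ht hy)
    have h3 : ‖x - y‖ ≤ 2 := (norm_sub_le x y).trans (by linarith)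
    calc ‖k (x - y)‖ ≤ ‖k‖ * ‖x - y‖ := k.le_opNorm _
      _ ≤ ‖k‖ * 2 := by gcongr
      _ = 2 * ‖k‖ := mul_comm _ _
  rw [Metric.mem_ball]
  change dist (g x) (g y) < ε
  rw [dist_eq_norm, ← map_sub]
  calc ‖g (x - y)‖ ≤ ‖f (x - y)‖ ^ θ * ‖k (x - y)‖ ^ (1 - θ) := h _
    _ ≤ η ^ θ * C := by
      rw [hC]
      gcongr
    _ < ε := by
      rw [hηθ, div_mul_eq_mul_div, div_lt_iff₀ (by positivity)]
      nlinarith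

theorem exists_eLpNorm_le_mul_of_le {α : Type*} [MeasurableSpace α] {μ : Measure α}
    [IsFiniteMeasure μ] {r R : ℝ≥0∞} (hr : 1 ≤ r) (hrR : r ≤ R) :
    ∃ K : ℝ≥0, ∀ f : α → ℝ, AEStronglyMeasurable f μ → eLpNorm f r μ ≤ K * eLpNorm f R μ := by
  have hexp : 0 ≤ 1 / r.toReal - 1 / R.toReal := by
    rcases eq_or_ne R ∞ with rfl | hR
    · simp
    · rw [sub_nonneg]
      have := ENNReal.toReal_mono hR hrR
      have hr0 : 0 < r.toReal :=
        ENNReal.toReal_pos (one_pos.trans_le hr).ne' (ne_top_of_le_ne_top hR hrR)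
      gcongr
  lift μ Set.univ ^ (1 / r.toReal - 1 / R.toReal) to ℝ≥0 using
    ENNReal.rpow_ne_top_of_nonneg hexp (measure_ne_top _ _) with K hK
  refine ⟨K, fun f hf => ?_⟩
  rw [hK, mul_comm]
  exact eLpNorm_le_eLpNorm_mul_rpow_measure_univ hrR hf

/-- Gagliardo seminorms on a bounded domain decrease when both the integrability exponent and the
exponent of the denominator decrease. -/
theorem exists_gagliardo_le (hΩ : IsBoundedLipschitzDomain Ω) {σ P : ℝ} (hP : 1 ≤ P)
    (hPp : ENNReal.ofReal P ≤ p) (hσ : (n : ℝ) / P + σ ≤ (n : ℝ) / p.toReal + s) :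
    ∃ K : ℝ≥0, ∀ u : EuclideanSpace ℝ (Fin n) → ℝ, AEStronglyMeasurable u (volume.restrict Ω) →
      gagliardo Ω σ (ENNReal.ofReal P) u ≤ K * gagliardo Ω s p u := by
  have := hΩ.isFiniteMeasure
  obtain ⟨K, hK⟩ := exists_eLpNorm_le_mul_of_le
    (μ := (volume.restrict Ω).prod (volume.restrict Ω)) (ofReal_one_le hP) hPp
  obtain ⟨d, hd⟩ := Metric.isBounded_iff.1 hΩ.isBounded
  -- The quotients differ by the factor `‖x - y‖^e`, which boundedness of `Ω` controls by `d^e` as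
  -- `e ≥ 0`.
  set e := (n : ℝ) / p.toReal + s - ((n : ℝ) / P + σ) with he
  have he0 : 0 ≤ e := by linarith
  have hpt : ∀ (u : EuclideanSpace ℝ (Fin n) → ℝ) {x y : EuclideanSpace ℝ (Fin n)}, x ∈ Ω → y ∈ Ω →
      ‖quotient σ (ENNReal.ofReal P) u (x, y)‖ ≤ d ^ e * ‖quotient s p u (x, y)‖ := by
    intro u x y hx hy
    rcases eq_or_ne x y with rfl | hxy
    · simp [quotient]
    · have hpos : 0 < ‖x - y‖ := norm_pos_iff.2 (sub_ne_zero.2 hxy)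
      have hle : ‖x - y‖ ^ e ≤ d ^ e := by
        rw [← dist_eq_norm] at hpos ⊢
        exact Real.rpow_le_rpow hpos.le (hd hx hy) he0
      have heq : ‖quotient σ (ENNReal.ofReal P) u (x, y)‖ =
          ‖x - y‖ ^ e * ‖quotient s p u (x, y)‖ := by
        simp only [quotient, norm_div, Real.norm_eq_abs, abs_of_pos (Real.rpow_pos_of_pos hpos _),
          ENNReal.toReal_ofReal (zero_le_one.trans hP)]
        rw [he, Real.rpow_sub hpos]
        have h1 := (Real.rpow_pos_of_pos hpos ((n : ℝ) / p.toReal + s)).ne'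
        field_simp
      rw [heq]
      gcongr
  refine ⟨(d ^ e).toNNReal * K, fun u hu => ?_⟩
  have h1 : gagliardo Ω σ (ENNReal.ofReal P) u ≤ ENNReal.ofReal (d ^ e) *
      eLpNorm (quotient s p u) (ENNReal.ofReal P)
        ((volume.restrict Ω).prod (volume.restrict Ω)) := by
    refine eLpNorm_le_mul_eLpNorm_of_ae_le_mul ?_ _
    have hmem := ae_restrict_mem (μ := volume) hΩ.isOpen.measurableSet
    filter_upwards [Measure.quasiMeasurePreserving_fst.ae hmem,
      Measure.quasiMeasurePreserving_snd.ae hmem] with z hz1 hz2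
    exact hpt u hz1 hz2
  refine h1.trans ?_
  rw [ENNReal.coe_mul, mul_assoc]
  exact mul_le_mul_right (hK _ (aestronglyMeasurable_quotient hu)) _

/-- The Sobolev bound on the functions in `C¹`, in all exponents up to the critical one. -/
theorem exists_bound (hn : 0 < n) (hΩ : IsBoundedLipschitzDomain Ω) (hq : 1 ≤ q) {σ P t : ℝ}
    (hP : 1 ≤ P) (hσ : 0 < σ) (hσP : σ * P < n) (ht : t = n * P / (n - σ * P)) (ht1 : 1 ≤ t)
    {K : ℝ≥0}
    (hK : ∀ u : C1 Ω s q p, gagliardo Ω σ (ENNReal.ofReal P) u.fn ≤ K * gagliardo Ω s p u.fn)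
    {r : ℝ≥0∞} (hr : 1 ≤ r) (hrt : r ≤ max (ENNReal.ofReal t) q) :
    ∃ C : ℝ≥0, ∀ u : C1 Ω s q p, eLpNorm u.fn r (volume.restrict Ω) ≤
      C * (eLpNorm u.fn q (volume.restrict Ω) + gagliardo Ω s p u.fn) := by
  have := hΩ.isFiniteMeasure
  rcases le_max_iff.1 hrt with h | h
  · obtain ⟨R, hR, c, hc, hdens⟩ := hΩ.exists_volume_ball_ge
    obtain ⟨K₁, hK₁⟩ := exists_eLpNorm_le_mul_of_le (μ := volume.restrict Ω) hr h
    obtain ⟨K₂, hK₂⟩ := exists_eLpNorm_le hn hP hσ hσP hR hc ht ht1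
      (ae_restrict_of_forall_mem hΩ.isOpen.measurableSet hdens)
    obtain ⟨K₃, hK₃⟩ := exists_eLpNorm_le_mul_of_le (μ := volume.restrict Ω) le_rfl hq
    refine ⟨K₁ * (K₂ * (K₃ + K)), fun u => ?_⟩
    have hu := u.memLp.1
    calc eLpNorm u.fn r (volume.restrict Ω)
        ≤ K₁ * (K₂ * (K₃ * eLpNorm u.fn q (volume.restrict Ω) + K * gagliardo Ω s p u.fn)) := by
          refine (hK₁ _ hu).trans ?_
          gcongr
          refine (hK₂ _ hu).trans ?_
          gcongr
          · exact hK₃ _ hu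
          · exact hK u
      _ ≤ K₁ * (K₂ * ((K₃ + K) * eLpNorm u.fn q (volume.restrict Ω) +
            (K₃ + K) * gagliardo Ω s p u.fn)) := by
          gcongr
          · exact le_self_add
          · exact le_add_self
      _ = _ := by
          push_cast
          ring
  · obtain ⟨K₁, hK₁⟩ := exists_eLpNorm_le_mul_of_le (μ := volume.restrict Ω) hr h
    refine ⟨K₁, fun u => (hK₁ _ u.memLp.1).trans ?_⟩
    gcongr
    exact le_self_add

/-- The averaging argument gives compactness in `L^1`; the strict inequality `r < R` leaves room to
interpolate with boundedness in `L^R`. -/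
theorem compactlyEmbeds_of_bound [Fact (1 ≤ q)] [Fact (1 ≤ p)] (hΩ : IsBoundedLipschitzDomain Ω)
    {σ P : ℝ} (hP : 1 ≤ P) (hσ : 0 < σ) {K : ℝ≥0}
    (hK : ∀ u : C1 Ω s q p, gagliardo Ω σ (ENNReal.ofReal P) u.fn ≤ K * gagliardo Ω s p u.fn)
    {r R : ℝ≥0∞} [hr : Fact (1 ≤ r)] (hrR : r < R) {C : ℝ≥0}
    (hC : ∀ u : C1 Ω s q p, eLpNorm u.fn R (volume.restrict Ω) ≤
      C * (eLpNorm u.fn q (volume.restrict Ω) + gagliardo Ω s p u.fn)) :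
    CompactlyEmbeds Ω s q p r := by
  have := hΩ.isFiniteMeasure
  have : Fact (1 ≤ R) := ⟨hr.out.trans hrR.le⟩
  have hbound : ∀ {τ : ℝ≥0∞} [Fact (1 ≤ τ)], τ ≤ R → ContinuouslyEmbeds Ω s q p τ := by
    intro τ hτ hτR
    obtain ⟨K', hK'⟩ := exists_eLpNorm_le_mul_of_le (μ := volume.restrict Ω) hτ.out hτR
    refine continuouslyEmbeds_of_bound (K' * C) fun u => (hK' _ u.memLp.1).trans ?_
    rw [ENNReal.coe_mul, mul_assoc]
    gcongr
    exact hC u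
  obtain ⟨ι₁, hι₁⟩ := hbound (τ := 1) (hr.out.trans hrR.le)
  have hcomp := isCompactOperator_of_gagliardo_le hΩ hσ hP hK hι₁
  rcases hr.out.eq_or_lt with rfl | hr1
  · exact ⟨ι₁, hι₁, hcomp⟩
  obtain ⟨ι, hι⟩ := hbound hrR.le
  obtain ⟨κ, hκ⟩ := hbound (le_refl R)
  obtain ⟨θ, hθ0, hθ1, hθ⟩ := exists_eLpNorm_le_interpolation (μ := volume.restrict Ω) hr1 hrR
  refine ⟨ι, hι, isCompactOperator_of_norm_le_interpolation (f := ι₁) (k := κ) hθ0 hθ1 ?_ hcomp⟩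
  intro x
  induction x using UniformSpace.Completion.induction_on with
  | hp =>
    refine isClosed_le (by fun_prop) (Continuous.mul ?_ ?_)
    · exact (continuous_norm.comp ι₁.continuous).rpow_const fun _ => Or.inr hθ0.le
    · exact (continuous_norm.comp κ.continuous).rpow_const fun _ => Or.inr (by linarith)
  | ih u =>
    have h1 := ENNReal.toReal_mono (ENNReal.mul_ne_top
      (ENNReal.rpow_ne_top_of_nonneg hθ0.le (Lp.eLpNorm_ne_top (ι₁ u)))
      (ENNReal.rpow_ne_top_of_nonneg (show 0 ≤ 1 - θ by linarith) (Lp.eLpNorm_ne_top (κ u))))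
      (le_of_le_of_eq (hθ u.fn u.memLp.1) (by
        rw [eLpNorm_congr_ae (hι₁.2 u), eLpNorm_congr_ae (hκ.2 u)]))
    rwa [← eLpNorm_congr_ae (hι.2 u), ENNReal.toReal_mul, ← ENNReal.toReal_rpow,
      ← ENNReal.toReal_rpow, ← Lp.norm_def, ← Lp.norm_def, ← Lp.norm_def] at h1

end FracSobolev

/-! ### The subcritical and the remaining case. -/

theorem proposition1 (n : ℕ) (hn : 2 ≤ n) (p q : ℝ≥0∞) [Fact (1 ≤ p)] [Fact (1 ≤ q)]
    (s : ℝ) (hs0 : 0 < s) (hs1 : s < 1)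
    (Ω : Set (EuclideanSpace ℝ (Fin n))) (hΩ : IsBoundedLipschitzDomain Ω) :
    (ENNReal.ofReal s * p < n → ∀ (r : ℝ≥0∞) [Fact (1 ≤ r)],
      (r ≤ max (FracSobolev.criticalExponent n s p) q →
        FracSobolev.ContinuouslyEmbeds Ω s q p r) ∧
      (r < max (FracSobolev.criticalExponent n s p) q →
        FracSobolev.CompactlyEmbeds Ω s q p r)) ∧
    (n ≤ ENNReal.ofReal s * p → ∀ (r : ℝ≥0∞) [Fact (1 ≤ r)],
      r < ∞ → FracSobolev.CompactlyEmbeds Ω s q p r) := by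
  have hn0 : 0 < n := by omega
  have hn2 : (2 : ℝ) ≤ n := by exact_mod_cast hn
  have hν : (0 : ℝ) < n := by linarith
  have hp1 : 1 ≤ p := Fact.out
  have hq1 : 1 ≤ q := Fact.out
  have := hΩ.isFiniteMeasure
  have hs0' : ENNReal.ofReal s ≠ 0 := (ENNReal.ofReal_pos.2 hs0).ne'
  refine ⟨fun hsp => ?_, fun hsp r hr hrt => ?_⟩
  · have hpt : p ≠ ∞ := by
      rintro rfl
      rw [ENNReal.mul_top hs0'] at hsp
      exact not_top_lt hsp
    obtain ⟨P, hP, rfl⟩ : ∃ P : ℝ, 1 ≤ P ∧ p = ENNReal.ofReal P :=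
      ⟨p.toReal, by simpa using ENNReal.toReal_mono hpt hp1, (ENNReal.ofReal_toReal hpt).symm⟩
    have hP0 : 0 < P := by linarith
    have hsP : s * P < n := by
      rw [← ENNReal.ofReal_mul hs0.le, ← ENNReal.ofReal_natCast,
        ENNReal.ofReal_lt_ofReal_iff hν] at hsp
      exact hsp
    have hd : 0 < n - s * P := by linarith
    have hcrit : FracSobolev.criticalExponent n s (ENNReal.ofReal P) =
        ENNReal.ofReal (n * P / (n - s * P)) := by
      rw [FracSobolev.criticalExponent, ENNReal.ofReal_div_of_pos hd, ENNReal.ofReal_mul hν.le,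
        ENNReal.ofReal_sub _ (by positivity), ENNReal.ofReal_mul hs0.le, ENNReal.ofReal_natCast]
    have ht1 : 1 ≤ n * P / (n - s * P) := by
      rw [le_div_iff₀ hd]
      nlinarith
    have hK : ∀ u : FracSobolev.C1 Ω s q (ENNReal.ofReal P),
        FracSobolev.gagliardo Ω s (ENNReal.ofReal P) u.fn ≤
          (1 : ℝ≥0) * FracSobolev.gagliardo Ω s (ENNReal.ofReal P) u.fn := fun u => by simp
    intro r hr
    rw [hcrit]
    refine ⟨fun h => ?_, fun h => ?_⟩
    · obtain ⟨C, hC⟩ := FracSobolev.exists_bound hn0 hΩ hq1 hP hs0 hsP rfl ht1 hK hr.out h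
      exact FracSobolev.continuouslyEmbeds_of_bound C hC
    · obtain ⟨C, hC⟩ := FracSobolev.exists_bound hn0 hΩ hq1 hP hs0 hsP rfl ht1 hK
        (hr.out.trans h.le) le_rfl
      exact FracSobolev.compactlyEmbeds_of_bound hΩ hP hs0 hK h hC
  -- For finite `p` take `P = p`, as then `n/P ≤ s`. For `p = ∞` take `P = 2n/s`: then `n/P = s/2`,
  -- and `n/P + σ < s` for every `σ < n/P`.
  · obtain ⟨P, hP, hPp, hsP⟩ : ∃ P : ℝ, 1 ≤ P ∧ ENNReal.ofReal P ≤ p ∧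
        (∀ σ, σ < n / P → n / P + σ ≤ n / p.toReal + s) := by
      rcases eq_or_ne p ∞ with rfl | hpt
      · refine ⟨2 * n / s, ?_, le_top, fun σ hσ => ?_⟩
        · rw [le_div_iff₀ hs0]
          linarith
        · have h : (n : ℝ) / (2 * n / s) = s / 2 := by field_simp
          rw [h] at hσ ⊢
          simp only [ENNReal.toReal_top, div_zero]
          linarith
      · have hP1 : 1 ≤ p.toReal := by simpa using ENNReal.toReal_mono hpt hp1
        refine ⟨p.toReal, hP1, (ENNReal.ofReal_toReal hpt).le, fun σ hσ => ?_⟩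
        have h : (n : ℝ) ≤ s * p.toReal := by
          have := ENNReal.toReal_mono (ENNReal.mul_ne_top ENNReal.ofReal_ne_top hpt) hsp
          simpa [ENNReal.toReal_mul, ENNReal.toReal_ofReal hs0.le] using this
        have h' : n / p.toReal ≤ s := (div_le_iff₀ (by linarith)).2 h
        linarith
    have hP0 : 0 < P := by linarith
    set ρ := r.toReal + 1 with hρ
    have hρ1 : 1 ≤ ρ := by
      have : 0 ≤ r.toReal := ENNReal.toReal_nonneg
      linarith
    have hrρ : r < ENNReal.ofReal ρ := by
      rw [hρ, ← ENNReal.toReal_one, ← ENNReal.toReal_add hrt.ne ENNReal.one_ne_top,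
        ENNReal.ofReal_toReal (by finiteness)]
      exact ENNReal.lt_add_right hrt.ne one_ne_zero
    -- The first entry makes the critical exponent of `(σ, P)` at least `ρ > r`; the second keeps
    -- `σ` positive. Both are below `n/P`.
    set σ := max (n / P - n / ρ) (n / (2 * P)) with hσ
    have hσ0 : 0 < σ := lt_max_of_lt_right (by positivity)
    have hσP : σ < n / P := by
      refine max_lt ?_ ?_
      · have : 0 < n / ρ := by positivity
        linarith
      · gcongr
        linarith
    have hσP' : σ * P < n := (lt_div_iff₀ hP0).1 hσP
    have hd : 0 < n - σ * P := by linarith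
    have hρt : ρ ≤ n * P / (n - σ * P) := by
      have h1 : n / P - n / ρ ≤ σ := le_max_left _ _
      have h2 : n - σ * P ≤ n * P / ρ := by
        have h3 := mul_le_mul_of_nonneg_right h1 hP0.le
        rw [sub_mul, div_mul_cancel₀ _ hP0.ne', div_mul_eq_mul_div] at h3
        linarith
      rw [le_div_iff₀ hd, mul_comm]
      exact (le_div_iff₀ (by linarith)).1 h2
    obtain ⟨K, hK⟩ := FracSobolev.exists_gagliardo_le hΩ hP hPp (hsP σ hσP)
    have hK' := fun u : FracSobolev.C1 Ω s q p => hK u.fn u.memLp.1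
    obtain ⟨C, hC⟩ := FracSobolev.exists_bound hn0 hΩ hq1 hP hσ0 hσP' rfl (hρ1.trans hρt) hK'
      (hr.out.trans hrρ.le) (le_max_of_le_left (ENNReal.ofReal_le_ofReal hρt))
    exact FracSobolev.compactlyEmbeds_of_bound hΩ hP hσ0 hK' hrρ hC
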